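/- **Setting.** Let $\sigma$ be a substitution (morphism of $\{a,b\}^*$) over the binary alphabet, $A=\sigma(a)$, $B=\sigma(b)$, with incidence matrix $M$ (columns: the Parikh vectors of $A$ and $B$). Assume that $\sigma$ is well-marked ($A$ begins with $a$ and $B$ begins with $b$), primitive (some power of $M$ is positive), that the eigenvalues of $M$ are non-negative, and that $\sigma$ is non-periodic: $\xi=\sigma(\xi)$ is an infinite fixed point that is not ultimately periodic. Let $p(n)$ be the number of factors of $\xi$ of length $n$. A word $W$ is special if $Wa$ and $Wb$ are factors of $\xi$; $s(n)$ is the number of special words of length $n$. A special word $W$ is weak (strong) if neither (both) of $aW,bW$ is special. Let $W_0$ be the longest common suffix of the left-infinite words $\cdots AAA$ and $\cdots BBB$, and $T(W)=W_0\sigma(W)$. Call $C\in\mathbb N$ a recognizability constant if $\xi[i-C,i+C]=\xi[j-C,j+C]$ and $i\in E$ imply $j\in E$, where $E$ is the set of cutting positions of $\xi=\sigma(\xi_1)\sigma(\xi_2)\cdots$ (the starting positions of the blocks $\sigma(\xi_k)$). Put $L=\max\{2C+\max\{|A|,|B|\},|A|+|B|-1\}$, and let $\widetilde{\mathcal S}$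 be the finite set of weak or strong special words $W$ with $1\le|W|\le L<|T(W)|$; put $\operatorname{sgn}(W)=-1$ if $W\in\widetilde{\mathcal S}$ is weak, $+1$ if it is strong. **Theorem.** One has $s(n)=p(n+1)-p(n)$ for all $n\ge0$, and recognizability constants exist. Let $C$ be any one of them. (0) If $\widetilde{\mathcal S}=\emptyset$, then $s(n+1)=s(n)$ for all $n>L$. (1) For all $W_1,W_2\in\widetilde{\mathcal S}$ there are $m_1,m_2\in\mathbb N$ such that either $|T^{m_1+i}(W_1)|=|T^{m_2+i}(W_2)|<|T^{m_1+i+1}(W_1)|$ for all $i\ge0$, or $|T^{m_1+i}(W_1)|<|T^{m_2+i}(W_2)|<|T^{m_1+i+1}(W_1)|$ for all $i\ge0$. Fix any such choice $m_1(W_1,W_2)$, $m_2(W_1,W_2)$ for all pairs, and let $m$ be the maximum of these numbers. (2) Consider enumerations $\widetilde{\mathcal S}=\{S_1,\dots,S_K\}$ without repetition, $K\ge1$, with exponents $n_1,\dots,n_K>m$ such that $$|T^{n_1}(S_1)|\le|T^{n_2}(S_2)|\le\cdots\le|T^{n_K}(S_K)|<|T^{n_1+1}(S_1)|.$$ Every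 element of $\widetilde{\mathcal S}$ occurs as $S_1$ in such an enumeration, with any sufficiently large $n_1$; and if $\widetilde{\mathcal S}\neq\emptyset$, then some element occurs as $S_1$ with every $n_1>m$. (3) For any such enumeration and exponents put $N_k^j=|T^{j+n_k}(S_k)|$, $I^j=[N_1^j,N_1^{j+1})$, $I_k^j=[N_k^j,N_{k+1}^j)$ for $1\le k\le K$, where $N_{K+1}^j=N_1^{j+1}$, and $$c_k=\sum_{i:\,N_i^0=N_k^0}\operatorname{sgn}(S_i).$$ Write $\sum^{*}_{i\le k}c_i$ for the sum of $c_1,\dots,c_k$ in which indices with the same point $N_i^0$ are counted once (so it is $c_1+\cdots+c_k$ if the points $N_1^0,\dots,N_K^0$ are distinct). Then: * $n_k$ is the only $n$ with $|T^n(S_k)|\in I^0$; for all $j\ge0$, $N_1^j\le N_2^j\le\cdots\le N_K^j<N_1^{j+1}$; $[N_1^0,\infty)$ is the disjoint union of the $I^j$, and $I^j$ is the disjoint union of $I_1^j,\dots,I_K^j$. * For all $j\ge0$ and $n\in I^j$, $$s(n+1)=s(N_1^j)+\sum_{k=1}^K\Bigl(\sum^{*}_{i\le k}c_i\Bigr)\chi_{I_k^j}(n).$$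 * The jumps are the same on every block: $s(n+1)-s(n)=c_k$ for $n=N_k^j$, and $s(n+1)=s(n)$ for every $n\ge N_1^0$ that is none of the points $N_k^j$. * The points satisfy $N_k^{j+2}=\operatorname{tr}(M)N_k^{j+1}-\det(M)N_k^j+\alpha$ with $\alpha=|\sigma(W_0)|-(\operatorname{tr}(M)-1)|W_0|$. * Hence $p$ is determined by finitely many initial values: if sequences $(\nu_k^j)_{j\ge0}$ of natural numbers ($1\le k\le K$) satisfy this recurrence with $\nu_k^0=N_k^0$, $\nu_k^1=N_k^1$, and $P:\mathbb N\to\mathbb Z$ agrees with $p$ on $[0,N_1^0+1]$ and satisfies $P(n+2)-P(n+1)=P(\nu_1^j+1)-P(\nu_1^j)+\sum_{k=1}^K(\sum^{*}_{i\le k}c_i)\chi_{J_k^j}(n)$ for all $j\ge0$ and $\nu_1^j\le n<\nu_1^{j+1}$, where $J_k^j=[\nu_k^j,\nu_{k+1}^j)$ and $\nu_{K+1}^j=\nu_1^{j+1}$, then $P(n)=p(n)$ for all $n$. -/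

import Mathlib

namespace BinSubst

/-- Finite words over the binary alphabet `{a, b}`, where `a = 0` and `b = 1`. -/
abbrev Word : Type := List (Fin 2)

/-- A substitution, given by the images of the two letters: `A = σ 0` and `B = σ 1`. -/
abbrev Subst : Type := Fin 2 → Word

/-- The morphism of the free monoid determined by `σ`. -/
def Subst.app (σ : Subst) (w : Word) : Word := w.flatMap σ

/-- `σ(a) = a⋯` and `σ(b) = b⋯`. -/
def WellMarked (σ : Subst) : Prop :=
  (∃ u : Word, σ 0 = 0 :: u) ∧ ∃ v : Word, σ 1 = 1 :: v

/-- The incidence matrix: column `j` is the Parikh vector of `σ j`. -/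
def incidence (σ : Subst) : Matrix (Fin 2) (Fin 2) ℤ :=
  Matrix.of fun i j => ((σ j).count i : ℤ)

/-- All complex eigenvalues of the incidence matrix are real and non-negative. -/
def NonnegEigenvalues (σ : Subst) : Prop :=
  ∀ μ : ℂ, Module.End.HasEigenvalue
    (Matrix.toLin' ((incidence σ).map (Int.cast : ℤ → ℂ))) μ → 0 ≤ μ.re ∧ μ.im = 0

/-! ### Infinite words; letters are indexed from `0` -/

/-- The factor of length `n` of `ξ` at position `i`. -/
def factorAt (ξ : ℕ → Fin 2) (i n : ℕ) : Word := (List.range n).map fun t => ξ (i + t)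

/-- `w` is a factor of `ξ`. -/
def IsFactor (ξ : ℕ → Fin 2) (w : Word) : Prop := ∃ i : ℕ, w = factorAt ξ i w.length

/-- `σ(ξ) = ξ`: the image of every prefix of `ξ` is a prefix of `ξ`. -/
def IsFixedPoint (σ : Subst) (ξ : ℕ → Fin 2) : Prop :=
  ∀ n : ℕ, σ.app (factorAt ξ 0 n) = factorAt ξ 0 (σ.app (factorAt ξ 0 n)).length

def UltimatelyPeriodic (ξ : ℕ → Fin 2) : Prop :=
  ∃ q : ℕ, 0 < q ∧ ∃ n₀ : ℕ, ∀ n : ℕ, n₀ ≤ n → ξ (n + q) = ξ n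

/-- The complexity `p(n)`: the number of factors of length `n`. -/
noncomputable def complexity (ξ : ℕ → Fin 2) (n : ℕ) : ℕ :=
  {w : Word | IsFactor ξ w ∧ w.length = n}.ncard

/-! ### Special words -/

/-- (Right) special words. -/
def Special (ξ : ℕ → Fin 2) (w : Word) : Prop := IsFactor ξ (w ++ [0]) ∧ IsFactor ξ (w ++ [1])

/-- The number `s(n)` of special words of length `n`. -/
noncomputable def specialCount (ξ : ℕ → Fin 2) (n : ℕ) : ℕ :=
  {w : Word | Special ξ w ∧ w.length = n}.ncard

/-- Weak special words. -/
def WeakSpecial (ξ : ℕ → Fin 2) (w : Word) : Prop :=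
  Special ξ w ∧ ¬ Special ξ (0 :: w) ∧ ¬ Special ξ (1 :: w)

/-- Strong special words. -/
def StrongSpecial (ξ : ℕ → Fin 2) (w : Word) : Prop :=
  Special ξ w ∧ Special ξ (0 :: w) ∧ Special ξ (1 :: w)

/-! ### The word `W₀` and the operator `T` -/

/-- The letter with index `i`, counted from the right and from `0`, of the left-infinite
word `⋯uuu` (for `u` non-empty). -/
def leftInf (u : Word) (i : ℕ) : Fin 2 := u.reverse.getD (i % u.length) 0

/-- The length of the longest common suffix of `⋯AAA` and `⋯BBB`, that is, the least index from
the right at which they differ (they do differ when `σ` is non-periodic). -/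
noncomputable def w0Length (σ : Subst) : ℕ := sInf {i : ℕ | leftInf (σ 0) i ≠ leftInf (σ 1) i}

/-- `W₀`, the longest common suffix of `⋯AAA` and `⋯BBB`. -/
noncomputable def w0 (σ : Subst) : Word :=
  ((List.range (w0Length σ)).map (leftInf (σ 0))).reverse

/-- `T(W) = W₀ σ(W)`. -/
noncomputable def opT (σ : Subst) (w : Word) : Word := w0 σ ++ σ.app w

/-! ### Recognizability and the initial special words -/

/-- The cutting positions of `ξ`. -/
def cuts (σ : Subst) (ξ : ℕ → Fin 2) : Set ℕ :=
  Set.range fun k : ℕ => (σ.app (factorAt ξ 0 k)).length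

/-- `C` is a recognizability constant: if `ξ[i-C, i+C] = ξ[j-C, j+C]` and `i` is a cutting
position, then so is `j`. Here `i = i' + C` and `j = j' + C`. -/
def IsRecogConst (σ : Subst) (ξ : ℕ → Fin 2) (C : ℕ) : Prop :=
  ∀ i' j' : ℕ, factorAt ξ i' (2 * C + 1) = factorAt ξ j' (2 * C + 1) →
    i' + C ∈ cuts σ ξ → j' + C ∈ cuts σ ξ

/-- `L = max {2C + max {|A|, |B|}, |A| + |B| - 1}`. -/
def bigL (σ : Subst) (C : ℕ) : ℕ :=
  max (2 * C + max (σ 0).length (σ 1).length) ((σ 0).length + (σ 1).length - 1)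

/-- The initial strong special words: `1 ≤ |W| ≤ L < |T(W)|`. -/
def initStrong (σ : Subst) (ξ : ℕ → Fin 2) (C : ℕ) : Set Word :=
  {w | StrongSpecial ξ w ∧ 1 ≤ w.length ∧ w.length ≤ bigL σ C ∧ bigL σ C < (opT σ w).length}

/-- The initial weak special words: `1 ≤ |W| ≤ L < |T(W)|`. -/
def initWeak (σ : Subst) (ξ : ℕ → Fin 2) (C : ℕ) : Set Word :=
  {w | WeakSpecial ξ w ∧ 1 ≤ w.length ∧ w.length ≤ bigL σ C ∧ bigL σ C < (opT σ w).length}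

/-- The initial special words. -/
def initSpecial (σ : Subst) (ξ : ℕ → Fin 2) (C : ℕ) : Set Word :=
  initWeak σ ξ C ∪ initStrong σ ξ C

open Classical in
/-- `-1` on the initial weak, `1` on the initial strong special words, and `0` elsewhere. -/
noncomputable def sgn (σ : Subst) (ξ : ℕ → Fin 2) (C : ℕ) (w : Word) : ℤ :=
  if w ∈ initWeak σ ξ C then -1 else if w ∈ initStrong σ ξ C then 1 else 0

/-! ### Synchronization and the intervals -/

/-- From the exponents `m₁`, `m₂` on, the lengths of the iterates of `T` on `W₁` and `W₂` either
coincide and increase, or interlace strictly. -/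
def Synchronized (σ : Subst) (W₁ W₂ : Word) (m₁ m₂ : ℕ) : Prop :=
  (∀ i : ℕ, ((opT σ)^[m₁ + i] W₁).length = ((opT σ)^[m₂ + i] W₂).length ∧
    ((opT σ)^[m₂ + i] W₂).length < ((opT σ)^[m₁ + i + 1] W₁).length) ∨
  (∀ i : ℕ, ((opT σ)^[m₁ + i] W₁).length < ((opT σ)^[m₂ + i] W₂).length ∧
    ((opT σ)^[m₂ + i] W₂).length < ((opT σ)^[m₁ + i + 1] W₁).length)

/-- `m₁`, `m₂` choose synchronizing exponents for every pair of words of `E`. -/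
def IsSyncChoice (σ : Subst) (E : Set Word) (m₁ m₂ : Word → Word → ℕ) : Prop :=
  ∀ W₁ ∈ E, ∀ W₂ ∈ E, Synchronized σ W₁ W₂ (m₁ W₁ W₂) (m₂ W₁ W₂)

/-- `N_k^j = |T^j(T^{n_k}(S_k))|`. -/
noncomputable def pointN (σ : Subst) (S : ℕ → Word) (e : ℕ → ℕ) (k j : ℕ) : ℕ :=
  ((opT σ)^[j + e k] (S k)).length

/-- `S_1, …, S_K` (`K ≥ 1`) enumerates `E` without repetition, the exponents `n_k = e k` exceed
all the synchronizing exponents, and `N_1^0 ≤ N_2^0 ≤ ⋯ ≤ N_K^0 < N_1^1`. -/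
structure IsUnison (σ : Subst) (E : Set Word) (m₁ m₂ : Word → Word → ℕ)
    (K : ℕ) (S : ℕ → Word) (e : ℕ → ℕ) : Prop where
  pos : 1 ≤ K
  enum : Set.BijOn S (Set.Icc 1 K) E
  large : ∀ k ∈ Set.Icc 1 K, ∀ W₁ ∈ E, ∀ W₂ ∈ E, m₁ W₁ W₂ < e k ∧ m₂ W₁ W₂ < e k
  sorted : ∀ k ∈ Set.Ico 1 K, pointN σ S e k 0 ≤ pointN σ S e (k + 1) 0
  last : pointN σ S e K 0 < pointN σ S e 1 1

/-- `I^j = [N_1^j, N_1^{j+1})`. -/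
def block (N : ℕ → ℕ → ℕ) (j : ℕ) : Set ℕ := Set.Ico (N 1 j) (N 1 (j + 1))

/-- `I_k^j = [N_k^j, N_{k+1}^j)` for `1 ≤ k ≤ K`, where `N_{K+1}^j = N_1^{j+1}`. -/
def subblock (K : ℕ) (N : ℕ → ℕ → ℕ) (k j : ℕ) : Set ℕ :=
  Set.Ico (N k j) (if k < K then N (k + 1) j else N 1 (j + 1))

/-- `c_k = ∑_{i=1}^K sgn(S_i) δ(N_i^0, N_k^0)`. -/
noncomputable def jump (σ : Subst) (ξ : ℕ → Fin 2) (C K : ℕ) (S : ℕ → Word) (e : ℕ → ℕ)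
    (k : ℕ) : ℤ :=
  ∑ i ∈ Finset.Icc 1 K,
    if pointN σ S e i 0 = pointN σ S e k 0 then sgn σ ξ C (S i) else 0

/-- The total jump `c_1 + ⋯ + c_k`, in which coinciding points `N_i^0` count as one point:
`c_i` already is the whole jump at `N_i^0`. -/
noncomputable def totalJump (σ : Subst) (ξ : ℕ → Fin 2) (C K : ℕ) (S : ℕ → Word) (e : ℕ → ℕ)
    (k : ℕ) : ℤ :=
  ∑ i ∈ (Finset.Icc 1 k).filter
      (fun i => ∀ h < i, 1 ≤ h → pointN σ S e h 0 ≠ pointN σ S e i 0),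
    jump σ ξ C K S e i

/-- `∑_{k=1}^K d_k χ_{I_k^j}(n)`. -/
noncomputable def stepSum (K : ℕ) (N : ℕ → ℕ → ℕ) (d : ℕ → ℤ) (j n : ℕ) : ℤ :=
  ∑ k ∈ Finset.Icc 1 K, d k * (subblock K N k j).indicator (fun _ => 1) n

/-- The sequence `x` satisfies `x_{j+2} = tr(M) x_{j+1} - det(M) x_j + a` with
`a = |σ(W₀)| - (tr(M) - 1)|W₀|`. -/
def LengthRecurrence (σ : Subst) (x : ℕ → ℕ) : Prop :=
  ∀ j : ℕ, (x (j + 2) : ℤ) =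
    (incidence σ).trace * x (j + 1) - (incidence σ).det * x j +
      (((σ.app (w0 σ)).length : ℤ) - ((incidence σ).trace - 1) * (w0 σ).length)

end BinSubst

open BinSubst

namespace BinSubst

/-! ### Morphisms and factors -/

/-! The jumps of s come from strong and weak words: s(n+1) - s(n) is the number of strong minus the
number of weak words of length n (`specialCount_succ`). The operator T transports these words. As A
and B begin with different letters, σ preserves branching on the right; as W₀ is the longest common
suffix of ⋯AAA and ⋯BBB, the two letters that can precede W become, through a permutation γ, the two
letters preceding T(W) (`exists_cons_opT_suffix`). Conversely, recognizability forces a long special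
word to end at a cutting position in all its right-branching occurrences, so it is a suffix of T(W)
with W special (`Special.exists_suffix_opT`). Hence beyond length L the weak and strong words are
exactly the iterates of T on the initial ones, each obtained once because T is injective
(`ncard_eq_ncard_orbit`).

It remains to understand the lengths |Tⁿ(S)|. By Cayley–Hamilton they satisfy an affine binary
recurrence with the characteristic polynomial of M, so the difference of two such sequences, shifted
arbitrarily, satisfies the homogeneous one. The entries of M are positive, so its roots are real and
distinct; they are non-negative by assumption, which excludes oscillation, and every such difference
has an eventually constant sign (`eventually_sign_of_recurrence`). Two orbits therefore interlace or
coincide in a fixed manner from some exponents on (`exists_synchronized`). Past those exponents,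
each orbit has exactly one point in every block [|Tⁿ(S₁)|, |Tⁿ⁺¹(S₁)|), and order and coincidences
are the same in all blocks (`IsUnison.compare`, `IsUnison.exponent_eq`). So the pattern of jumps
repeats, and summation gives the formula for s.

Recognizability constants exist because two occurrences of a long word without a common cutting
position would force a long periodic factor (`exists_isRecogConst`), which recurrence and
aperiodicity forbid. -/

theorem app_nil (σ : Subst) : σ.app [] = [] := rfl

theorem app_append (σ : Subst) (u v : Word) : σ.app (u ++ v) = σ.app u ++ σ.app v :=
  List.flatMap_append

theorem app_cons (σ : Subst) (c : Fin 2) (v : Word) : σ.app (c :: v) = σ c ++ σ.app v :=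
  List.flatMap_cons

theorem app_singleton (σ : Subst) (c : Fin 2) : σ.app [c] = σ c := by
  simp [Subst.app]

theorem length_factorAt (ξ : ℕ → Fin 2) (i n : ℕ) : (factorAt ξ i n).length = n := by
  simp [factorAt]

theorem factorAt_getElem (ξ : ℕ → Fin 2) (i n t : ℕ) (h : t < (factorAt ξ i n).length) :
    (factorAt ξ i n)[t] = ξ (i + t) := by
  simp [factorAt]

theorem factorAt_one (ξ : ℕ → Fin 2) (i : ℕ) : factorAt ξ i 1 = [ξ i] := by
  simp [factorAt]

theorem factorAt_add (ξ : ℕ → Fin 2) (i m n : ℕ) :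
    factorAt ξ i (m + n) = factorAt ξ i m ++ factorAt ξ (i + m) n := by
  simp [factorAt, List.range_add, Function.comp_def, add_assoc]

theorem factorAt_succ (ξ : ℕ → Fin 2) (i n : ℕ) :
    factorAt ξ i (n + 1) = factorAt ξ i n ++ [ξ (i + n)] := by
  rw [factorAt_add, factorAt_one]

theorem factorAt_eq_iff (ξ : ℕ → Fin 2) (i j n : ℕ) :
    factorAt ξ i n = factorAt ξ j n ↔ ∀ t < n, ξ (i + t) = ξ (j + t) := by
  simp [factorAt]

theorem isFactor_factorAt (ξ : ℕ → Fin 2) (i n : ℕ) : IsFactor ξ (factorAt ξ i n) :=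
  ⟨i, by rw [length_factorAt]⟩

theorem eq_factorAt_of_append {ξ : ℕ → Fin 2} {u v w : Word} {i : ℕ}
    (h : u ++ v ++ w = factorAt ξ i (u ++ v ++ w).length) :
    v = factorAt ξ (i + u.length) v.length := by
  rw [List.length_append, List.length_append, factorAt_add, factorAt_add] at h
  have h₁ := (List.append_inj h (by simp [length_factorAt])).1
  exact (List.append_inj h₁ (by simp [length_factorAt])).2

theorem IsFactor.infix {ξ : ℕ → Fin 2} {v w : Word} (hw : IsFactor ξ w) (h : v <:+: w) :
    IsFactor ξ v := by
  obtain ⟨i, hi⟩ := hw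
  obtain ⟨u, u', rfl⟩ := h
  exact ⟨_, eq_factorAt_of_append hi⟩

theorem Special.suffix {ξ : ℕ → Fin 2} {v w : Word} (hw : Special ξ w) (h : v <:+ w) :
    Special ξ v := by
  obtain ⟨u, rfl⟩ := h
  exact ⟨hw.1.infix ⟨u, [], by simp⟩, hw.2.infix ⟨u, [], by simp⟩⟩

/-! ### Positivity of the incidence matrix -/

theorem WellMarked.exists_cons {σ : Subst} (hσ : WellMarked σ) (c : Fin 2) :
    ∃ u : Word, σ c = c :: u := by
  fin_cases c
  · exact hσ.1
  · exact hσ.2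

theorem WellMarked.length_pos {σ : Subst} (hσ : WellMarked σ) (c : Fin 2) :
    0 < (σ c).length := by
  obtain ⟨u, hu⟩ := hσ.exists_cons c
  simp [hu]

/-- A zero off the diagonal makes M triangular, and the same entry then vanishes in every power.
Primitivity enters the proof only through the resulting positivity of M itself. -/
theorem mem_image_of_isPrimitive {σ : Subst} (hσ : WellMarked σ)
    (hprim : (incidence σ).IsPrimitive) (c d : Fin 2) : d ∈ σ c := by
  by_cases hcd : d = c
  · obtain ⟨u, hu⟩ := hσ.exists_cons c
    simp [hu, hcd]
  by_contra hmem
  have h0 : incidence σ d c = 0 := by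
    simp [incidence, List.count_eq_zero_of_not_mem hmem]
  have key : ∀ k : ℕ, ((incidence σ) ^ k) d c = 0 := by
    intro k
    induction k with
    | zero => simp [hcd]
    | succ k ih =>
      rw [pow_succ, Matrix.mul_apply]
      refine Finset.sum_eq_zero fun x _ => ?_
      have : x = c ∨ x = d := by omega
      rcases this with rfl | rfl
      · rw [ih, zero_mul]
      · rw [h0, mul_zero]
  obtain ⟨k, -, hk⟩ := hprim.exists_pos_pow
  exact absurd (hk d c) (by rw [key k]; exact lt_irrefl _)

theorem two_le_length {σ : Subst} (hmem : ∀ c d, d ∈ σ c) (c : Fin 2) :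
    2 ≤ (σ c).length := by
  have h0 := hmem c 0
  have h1 := hmem c 1
  match hw : σ c with
  | [] => simp [hw] at h0
  | [x] => simp [hw] at h0 h1; omega
  | x :: y :: l => simp

/-! ### Cutting positions -/

/-- The position at which the image of the `k`-th letter starts. -/
def cutPos (σ : Subst) (ξ : ℕ → Fin 2) (k : ℕ) : ℕ := (σ.app (factorAt ξ 0 k)).length

theorem cutPos_zero (σ : Subst) (ξ : ℕ → Fin 2) : cutPos σ ξ 0 = 0 := rfl

theorem mem_cuts_iff {σ : Subst} {ξ : ℕ → Fin 2} {x : ℕ} :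
    x ∈ cuts σ ξ ↔ ∃ k, cutPos σ ξ k = x := Iff.rfl

theorem cutPos_mem_cuts (σ : Subst) (ξ : ℕ → Fin 2) (k : ℕ) : cutPos σ ξ k ∈ cuts σ ξ :=
  ⟨k, rfl⟩

theorem cutPos_add (σ : Subst) (ξ : ℕ → Fin 2) (k n : ℕ) :
    cutPos σ ξ (k + n) = cutPos σ ξ k + (σ.app (factorAt ξ k n)).length := by
  rw [cutPos, cutPos, factorAt_add, app_append, List.length_append, zero_add]

theorem cutPos_succ (σ : Subst) (ξ : ℕ → Fin 2) (k : ℕ) :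
    cutPos σ ξ (k + 1) = cutPos σ ξ k + (σ (ξ k)).length := by
  rw [cutPos_add, factorAt_one, app_singleton]

theorem factorAt_cutPos {σ : Subst} {ξ : ℕ → Fin 2} (hξ : IsFixedPoint σ ξ) (k n : ℕ) :
    factorAt ξ (cutPos σ ξ k) (σ.app (factorAt ξ k n)).length = σ.app (factorAt ξ k n) := by
  have h := hξ (k + n)
  rw [factorAt_add, app_append, List.length_append, factorAt_add, zero_add, zero_add] at h
  exact (List.append_inj h (by simp [length_factorAt])).2.symm

theorem strictMono_cutPos {σ : Subst} (hσ : WellMarked σ) (ξ : ℕ → Fin 2) :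
    StrictMono (cutPos σ ξ) :=
  strictMono_nat_of_lt_succ fun k => by
    have := hσ.length_pos (ξ k)
    rw [cutPos_succ]; omega

/-- σ(c) begins with c, so the letter read at a cutting position already tells which block starts
there. -/
theorem apply_cutPos {σ : Subst} {ξ : ℕ → Fin 2} (hσ : WellMarked σ) (hξ : IsFixedPoint σ ξ)
    (k : ℕ) : ξ (cutPos σ ξ k) = ξ k := by
  have h := factorAt_cutPos hξ k 1
  rw [factorAt_one, app_singleton] at h
  obtain ⟨u, hu⟩ := hσ.exists_cons (ξ k)
  rw [hu, List.length_cons, add_comm, factorAt_add, factorAt_one] at h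
  simpa using (List.cons.inj h).1

theorem apply_add_of_mem_cuts {σ : Subst} {ξ : ℕ → Fin 2} (hσ : WellMarked σ)
    (hξ : IsFixedPoint σ ξ) {x : ℕ} (hx : x ∈ cuts σ ξ) (t : ℕ) (ht : t < (σ (ξ x)).length) :
    ξ (x + t) = (σ (ξ x))[t] := by
  obtain ⟨k, rfl⟩ := mem_cuts_iff.1 hx
  have h := factorAt_cutPos hξ k 1
  rw [factorAt_one, app_singleton, ← apply_cutPos hσ hξ] at h
  rw [← factorAt_getElem ξ (cutPos σ ξ k) (σ (ξ (cutPos σ ξ k))).length t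
    (by rwa [length_factorAt])]
  simp only [h]

/-- The cutting position that follows the cutting position `x` is `x + |σ(ξ_x)|`. -/
theorem add_mem_cuts_iff {σ : Subst} {ξ : ℕ → Fin 2} (hσ : WellMarked σ)
    (hξ : IsFixedPoint σ ξ) {x : ℕ} (hx : x ∈ cuts σ ξ) (t : ℕ) (h0 : 0 < t)
    (ht : t ≤ (σ (ξ x)).length) : x + t ∈ cuts σ ξ ↔ t = (σ (ξ x)).length := by
  obtain ⟨k, rfl⟩ := mem_cuts_iff.1 hx
  have hs := cutPos_succ σ ξ k
  rw [apply_cutPos hσ hξ] at *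
  constructor
  · rintro ht'
    obtain ⟨l, hl⟩ := mem_cuts_iff.1 ht'
    have hkl : k < l := (strictMono_cutPos hσ ξ).lt_iff_lt.1 (by omega)
    have := (strictMono_cutPos hσ ξ).monotone (show k + 1 ≤ l from hkl)
    omega
  · rintro rfl
    exact ⟨k + 1, hs⟩

/-- The length of the longest image of a letter. -/
def maxLen (σ : Subst) : ℕ := max (σ 0).length (σ 1).length

theorem length_le_maxLen (σ : Subst) (c : Fin 2) : (σ c).length ≤ maxLen σ := by
  fin_cases c
  · exact le_max_left _ _
  · exact le_max_right _ _

theorem exists_cutPos_mem_Ico {σ : Subst} (hσ : WellMarked σ) (ξ : ℕ → Fin 2) (x : ℕ) :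
    ∃ k, x ≤ cutPos σ ξ k ∧ cutPos σ ξ k < x + maxLen σ := by
  have hM : 0 < maxLen σ := (hσ.length_pos 0).trans_le (length_le_maxLen σ 0)
  have hex : ∃ k, x ≤ cutPos σ ξ k := ⟨x, (strictMono_cutPos hσ ξ).le_apply⟩
  classical
  refine ⟨Nat.find hex, Nat.find_spec hex, ?_⟩
  rcases h : Nat.find hex with _ | k
  · rw [cutPos_zero]; omega
  · have hlt := Nat.find_min hex (m := k) (by omega)
    have := cutPos_succ σ ξ k
    have := length_le_maxLen σ (ξ k)
    omega

/-! ### Recurrence -/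

theorem cutPos_add_le (σ : Subst) (ξ : ℕ → Fin 2) (k n : ℕ) :
    cutPos σ ξ (k + n) ≤ cutPos σ ξ k + n * maxLen σ := by
  induction n with
  | zero => simp
  | succ n ih =>
    have := cutPos_succ σ ξ (k + n)
    have := length_le_maxLen σ (ξ (k + n))
    rw [add_mul, one_mul, ← add_assoc]
    omega

/-- Long prefixes of `ξ` that occur with bounded gaps. -/
theorem exists_prefix_bounded_gaps {σ : Subst} {ξ : ℕ → Fin 2} (hσ : WellMarked σ)
    (hmem : ∀ c d, d ∈ σ c) (hξ : IsFixedPoint σ ξ) (m : ℕ) :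
    ∃ n G : ℕ, m < n ∧ ∀ i, ∃ j, i ≤ j ∧ j < i + G ∧ factorAt ξ j n = factorAt ξ 0 n := by
  induction m with
  | zero =>
    -- A block starts within `maxLen σ` of any position, and every block contains both letters.
    refine ⟨1, 2 * maxLen σ, one_pos, fun i => ?_⟩
    obtain ⟨k, hk, hk'⟩ := exists_cutPos_mem_Ico hσ ξ i
    obtain ⟨t, ht, hct⟩ := List.mem_iff_getElem.1 (hmem (ξ (cutPos σ ξ k)) (ξ 0))
    have := apply_add_of_mem_cuts hσ hξ (cutPos_mem_cuts σ ξ k) t ht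
    have := length_le_maxLen σ (ξ (cutPos σ ξ k))
    refine ⟨cutPos σ ξ k + t, by omega, by omega, ?_⟩
    rw [factorAt_one, factorAt_one]
    simp_all
  | succ m ih =>
    obtain ⟨n, G, hn, hG⟩ := ih
    -- The image of an occurrence of the prefix of length n is an occurrence of a longer prefix. The
    -- gap allows for reaching the next cut and then passing fewer than G blocks.
    refine ⟨cutPos σ ξ n, maxLen σ + G * maxLen σ, ?_, fun i => ?_⟩
    · have h2 := two_le_length hmem (ξ 0)
      obtain ⟨n, rfl⟩ : ∃ n', n = n' + 1 := ⟨n - 1, by omega⟩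
      have h1 := cutPos_succ σ ξ 0
      rw [cutPos_zero] at h1
      have h3 : ∀ l, l + 1 < cutPos σ ξ (l + 1) := by
        intro l
        induction l with
        | zero => omega
        | succ l ih => exact lt_of_le_of_lt ih (strictMono_cutPos hσ ξ (Nat.lt_succ_self _))
      have := h3 n
      omega
    · obtain ⟨k, hk, hk'⟩ := exists_cutPos_mem_Ico hσ ξ i
      obtain ⟨j, hj, hj', hjn⟩ := hG k
      refine ⟨cutPos σ ξ j, hk.trans ((strictMono_cutPos hσ ξ).monotone hj), ?_, ?_⟩
      · obtain ⟨r, rfl⟩ := Nat.exists_eq_add_of_le hj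
        have h1 := cutPos_add_le σ ξ k r
        have h2 : r * maxLen σ ≤ G * maxLen σ := Nat.mul_le_mul_right _ (by omega)
        omega
      · have h1 := factorAt_cutPos hξ j n
        have h2 := factorAt_cutPos hξ 0 n
        rw [hjn] at h1
        rw [cutPos_zero] at h2
        exact h1.trans h2.symm

/-- Every word `ξ[0, n)` occurs in `ξ` with bounded gaps. -/
theorem prefix_bounded_gaps {σ : Subst} {ξ : ℕ → Fin 2} (hσ : WellMarked σ)
    (hmem : ∀ c d, d ∈ σ c) (hξ : IsFixedPoint σ ξ) (m : ℕ) :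
    ∃ G : ℕ, ∀ i, ∃ j, i ≤ j ∧ j < i + G ∧ ∀ t < m, ξ (j + t) = ξ t := by
  obtain ⟨n, G, hn, hG⟩ := exists_prefix_bounded_gaps hσ hmem hξ m
  refine ⟨G, fun i => ?_⟩
  obtain ⟨j, h1, h2, h3⟩ := hG i
  refine ⟨j, h1, h2, fun t ht => ?_⟩
  simpa using (factorAt_eq_iff ξ j 0 n).1 h3 t (by omega)

/-- Occurrences far to the right leave room for W₀ in front of the image of the factor. -/
theorem IsFactor.exists_ge {σ : Subst} {ξ : ℕ → Fin 2} (hσ : WellMarked σ)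
    (hmem : ∀ c d, d ∈ σ c) (hξ : IsFixedPoint σ ξ) {w : Word} (hw : IsFactor ξ w) (N : ℕ) :
    ∃ i, N ≤ i ∧ w = factorAt ξ i w.length := by
  obtain ⟨i, hi⟩ := hw
  obtain ⟨G, hG⟩ := prefix_bounded_gaps hσ hmem hξ (i + w.length)
  obtain ⟨j, hj, -, hjt⟩ := hG N
  refine ⟨j + i, by omega, hi.trans ((factorAt_eq_iff ξ _ _ _).2 fun t ht => ?_)⟩
  rw [add_assoc, hjt _ (by omega)]

/-- In an aperiodic fixed point, long factors do not have a given period. -/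
theorem exists_forall_not_periodic {σ : Subst} {ξ : ℕ → Fin 2} (hσ : WellMarked σ)
    (hmem : ∀ c d, d ∈ σ c) (hξ : IsFixedPoint σ ξ) (hper : ¬ UltimatelyPeriodic ξ)
    {q : ℕ} (hq : 0 < q) :
    ∃ Q : ℕ, ∀ i, ∃ t < Q, ξ (i + t + q) ≠ ξ (i + t) := by
  have : ∃ n, ξ (n + q) ≠ ξ n := by
    by_contra! h
    exact hper ⟨q, hq, 0, fun n _ => h n⟩
  obtain ⟨n, hn⟩ := this
  obtain ⟨G, hG⟩ := prefix_bounded_gaps hσ hmem hξ (n + q + 1)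
  refine ⟨G + n, fun i => ?_⟩
  obtain ⟨j, hj, hj', hjt⟩ := hG i
  refine ⟨j - i + n, by omega, ?_⟩
  rw [show i + (j - i + n) + q = j + (n + q) by omega, show i + (j - i + n) = j + n by omega,
    hjt _ (by omega), hjt _ (by omega)]
  exact hn

/-! ### Recognizability -/

/-- A common cutting position of two occurrences of the same word synchronizes the cutting
positions to its right. -/
theorem common_cut_propagates {σ : Subst} {ξ : ℕ → Fin 2} (hσ : WellMarked σ)
    (hξ : IsFixedPoint σ ξ) {i j n : ℕ} (heq : ∀ t < n, ξ (i + t) = ξ (j + t)) {t : ℕ}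
    (ht : t ≤ n) (hi : i + t ∈ cuts σ ξ) (hj : j + t ∈ cuts σ ξ) :
    (i + n ∈ cuts σ ξ ↔ j + n ∈ cuts σ ξ) ∧ (i + n ∉ cuts σ ξ → ξ (i + n) = ξ (j + n)) := by
  induction hd : n - t using Nat.strong_induction_on generalizing t with
  | _ d ih =>
  rcases ht.eq_or_lt with rfl | hlt
  · simp [hi, hj]
  have hc := heq t hlt
  have hpos := hσ.length_pos (ξ (i + t))
  have hi' := add_mem_cuts_iff hσ hξ hi
  have hj' := add_mem_cuts_iff hσ hξ hj
  have hil := apply_add_of_mem_cuts hσ hξ hi (n - t)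
  have hjl := apply_add_of_mem_cuts hσ hξ hj (n - t)
  simp only [← hc] at hj' hjl
  by_cases hle : t + (σ (ξ (i + t))).length ≤ n
  · refine ih _ ?_ hle ?_ ?_ rfl
    · omega
    · rw [← add_assoc, hi' _ hpos le_rfl]
    · rw [← add_assoc, hj' _ hpos le_rfl]
  -- The block starting at offset t reaches beyond offset n, and it is the same block in both
  -- occurrences, so both read the same letter at offset n.
  · rw [show i + n = i + t + (n - t) by omega, show j + n = j + t + (n - t) by omega,
      hi' _ (by omega) (by omega), hj' _ (by omega) (by omega)]
    exact ⟨Iff.rfl, fun _ => (hil (by omega)).trans (hjl (by omega)).symm⟩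

/-- A sequence over a finite set in which every term of a long interval is determined by the
preceding `M` terms is periodic on that interval, up to a bounded preperiod. -/
theorem exists_period_of_locally_determined {α : Type*} [Finite α] (M : ℕ) :
    ∃ N : ℕ, ∀ (g : ℕ → α) (R : ℕ),
      (∀ p p', p + M < R → p' + M < R → (∀ t < M, g (p + t) = g (p' + t)) →
        g (p + M) = g (p' + M)) →
      ∃ p p', p < p' ∧ p' ≤ N ∧ ∀ t, p' + t < R → g (p + t) = g (p' + t) := by
  -- Pigeonhole: among one more window of length M than there are words of length M, two coincide.
  refine ⟨Nat.card (Fin M → α), fun g R hdet => ?_⟩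
  have hninj : ¬ Function.Injective
      (fun (p : Fin (Nat.card (Fin M → α) + 1)) (t : Fin M) => g (p + t)) := by
    intro hinj
    have := Nat.card_le_card_of_injective _ hinj
    simp at this
  have main : ∀ p p' : ℕ, p < p' → (∀ t < M, g (p + t) = g (p' + t)) →
      ∀ t, p' + t < R → g (p + t) = g (p' + t) := by
    intro p p' hpp' hw t
    induction t using Nat.strong_induction_on with
    | _ t ih =>
    intro ht
    by_cases htM : t < M
    · exact hw t htM
    · have := hdet (p + (t - M)) (p' + (t - M)) (by omega) (by omega) (fun s hs => by
        rw [add_assoc, add_assoc]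
        exact ih _ (by omega) (by omega))
      rwa [show p + (t - M) + M = p + t by omega, show p' + (t - M) + M = p' + t by omega] at this
  rw [Function.Injective] at hninj
  push Not at hninj
  obtain ⟨a, b, hab, hne⟩ := hninj
  have hw : ∀ t < M, g (a + t) = g (b + t) := fun t ht => congrFun hab ⟨t, ht⟩
  rcases lt_or_gt_of_ne (Fin.val_ne_of_ne hne) with h | h
  · exact ⟨a, b, h, by omega, main a b h hw⟩
  · exact ⟨b, a, h, by omega, main b a h fun t ht => (hw t ht).symm⟩

/-- If the middle is a cut for only one of two matching occurrences, no cut to its left is common,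
since a common cut would propagate. Then the common letter together with both cut patterns is
locally determined: a position that is not a cut of the first occurrence has its letter forced by
the first parsing, and one that is a cut there is not a cut of the second, which forces the letter.
Hence the left half has a bounded preperiod and period. -/
theorem exists_isRecogConst {σ : Subst} {ξ : ℕ → Fin 2} (hσ : WellMarked σ)
    (hmem : ∀ c d, d ∈ σ c) (hξ : IsFixedPoint σ ξ) (hper : ¬ UltimatelyPeriodic ξ) :
    ∃ C, IsRecogConst σ ξ C := by
  obtain ⟨N, hN⟩ := exists_period_of_locally_determined (α := Fin 2 × Prop × Prop) (maxLen σ)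
  obtain ⟨Q, hQ⟩ := exists_forall_not_periodic hσ hmem hξ hper N.factorial_pos
  -- N bounds preperiod and period, so the period divides N!, which serves as a uniform period; Q
  -- positions further on it must be violated, and checking this needs N! more letters.
  refine ⟨N + Q + N.factorial, fun i j hij hi => ?_⟩
  set C := N + Q + N.factorial
  by_contra hj
  have heq : ∀ t < C, ξ (i + t) = ξ (j + t) := fun t ht =>
    (factorAt_eq_iff ξ i j _).1 hij t (by omega)
  have hdisj : ∀ t ≤ C, i + t ∈ cuts σ ξ → j + t ∉ cuts σ ξ := fun t ht hit hjt =>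
    hj ((common_cut_propagates hσ hξ heq ht hit hjt).1.1 hi)
  have hloc : ∀ x y : ℕ, (∀ t < maxLen σ, ξ (x + t) = ξ (y + t)) →
      (∀ t < maxLen σ, (x + t ∈ cuts σ ξ) = (y + t ∈ cuts σ ξ)) →
      (x + maxLen σ ∈ cuts σ ξ ↔ y + maxLen σ ∈ cuts σ ξ) ∧
        (x + maxLen σ ∉ cuts σ ξ → ξ (x + maxLen σ) = ξ (y + maxLen σ)) := by
    intro x y hxy hcut
    obtain ⟨k, hk, hk'⟩ := exists_cutPos_mem_Ico hσ ξ x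
    have hx : x + (cutPos σ ξ k - x) ∈ cuts σ ξ := by
      rw [Nat.add_sub_cancel' hk]; exact cutPos_mem_cuts σ ξ k
    exact common_cut_propagates hσ hξ hxy (t := cutPos σ ξ k - x)
      (show _ ≤ maxLen σ by omega) hx ((hcut (cutPos σ ξ k - x) (by omega)) ▸ hx)
  obtain ⟨p, p', hpp', hp'N, hgp⟩ := hN
    (fun t => (ξ (i + t), i + t ∈ cuts σ ξ, j + t ∈ cuts σ ξ)) C (by
      intro p p' hp hp' hw
      simp only [Prod.mk.injEq] at hw ⊢
      have h1 := hloc (i + p) (i + p') (fun t ht => by simpa only [add_assoc] using (hw t ht).1)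
        (fun t ht => by simpa only [add_assoc] using (hw t ht).2.1)
      have h2 := hloc (j + p) (j + p') (fun t ht => by
          have h := (hw t ht).1
          rw [heq _ (by omega), heq _ (by omega)] at h
          simpa only [add_assoc] using h)
        (fun t ht => by simpa only [add_assoc] using (hw t ht).2.2)
      simp only [add_assoc] at h1 h2
      refine ⟨?_, propext h1.1, propext h2.1⟩
      by_cases hc : i + (p + maxLen σ) ∈ cuts σ ξ
      · rw [heq _ hp, heq _ hp']
        exact h2.2 (hdisj _ hp.le hc)
      · exact h1.2 hc)
  have hper1 : ∀ t, p' + t < C → ξ (i + p + t) = ξ (i + p' + t) := fun t ht => by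
    simpa only [add_assoc] using (Prod.mk.inj (hgp t ht)).1
  obtain ⟨d, rfl⟩ := Nat.exists_eq_add_of_lt hpp'
  have hperr : ∀ r t, p + t + (d + 1) * r < C → ξ (i + p + t + (d + 1) * r) = ξ (i + p + t) := by
    intro r
    induction r with
    | zero => simp
    | succ r ih =>
      intro t ht
      have h1 : (d + 1) * (r + 1) = (d + 1) * r + (d + 1) := by ring
      have h2 := hper1 (t + (d + 1) * r) (by omega)
      rw [← ih t (by omega), h1, add_assoc (i + p) t ((d + 1) * r), h2]
      congr 1
      omega
  obtain ⟨r, hr⟩ : d + 1 ∣ N.factorial := Nat.dvd_factorial (by omega) (by omega)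
  obtain ⟨t, ht, hne⟩ := hQ (i + p)
  refine hne ?_
  have := hperr r t (by rw [← hr]; omega)
  rwa [← hr] at this

/-! ### The word `W₀` -/

theorem suffix_append_append {u v : Word} (h : u <:+ v) (w : Word) : u ++ w <:+ v ++ w := by
  obtain ⟨x, rfl⟩ := h
  exact ⟨x, by simp⟩

/-- The suffix of length `n` of the left-infinite word with letters `f`, counted from the right. -/
def leftWord (f : ℕ → Fin 2) (n : ℕ) : Word := ((List.range n).map f).reverse

theorem leftWord_succ (f : ℕ → Fin 2) (n : ℕ) : leftWord f (n + 1) = f n :: leftWord f n := by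
  simp [leftWord, List.range_succ]

theorem leftWord_suffix (f : ℕ → Fin 2) {m n : ℕ} (h : m ≤ n) :
    leftWord f m <:+ leftWord f n := by
  induction n, h using Nat.le_induction with
  | base => exact List.suffix_rfl
  | succ n _ ih => exact ih.trans (leftWord_succ f n ▸ List.suffix_cons _ _)

theorem leftWord_leftInf_add (u : Word) (n : ℕ) :
    leftWord (leftInf u) (u.length + n) = leftWord (leftInf u) n ++ u := by
  have h1 : (List.range u.length).map (leftInf u) = u.reverse := by
    refine List.ext_getElem (by simp) fun t h1 h2 => ?_
    have ht : t < u.length := by simpa using h1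
    simp [leftInf, Nat.mod_eq_of_lt ht, ht]
  have h2 : ∀ t, leftInf u (u.length + t) = leftInf u t := fun t => by simp [leftInf]
  simp only [leftWord, List.range_add, List.map_append, List.map_map, List.reverse_append, h1,
    List.reverse_reverse, Function.comp_def, h2]

/-- The last |A||B| letters of both left-infinite words consist of whole blocks, so they begin with
a and with b respectively. -/
theorem exists_leftInf_ne {σ : Subst} (hσ : WellMarked σ) :
    ∃ i, leftInf (σ 0) i ≠ leftInf (σ 1) i := by
  have key : ∀ (c : Fin 2) (m : ℕ), 0 < m →
      leftInf (σ c) ((σ c).length * m - 1) = c := by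
    intro c m hm
    obtain ⟨u, hu⟩ := hσ.exists_cons c
    obtain ⟨m, rfl⟩ : ∃ m', m = m' + 1 := ⟨m - 1, by omega⟩
    have : (σ c).length * (m + 1) - 1 = u.length + (σ c).length * m := by
      rw [mul_add, hu, List.length_cons]; omega
    rw [leftInf, this, Nat.add_mul_mod_self_left, hu, List.length_cons,
      Nat.mod_eq_of_lt (Nat.lt_succ_self _)]
    simp
  refine ⟨(σ 0).length * (σ 1).length - 1, ?_⟩
  rw [key 0 _ (hσ.length_pos 1), mul_comm, key 1 _ (hσ.length_pos 0)]
  decide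

theorem w0_eq_leftWord {σ : Subst} (c : Fin 2) :
    w0 σ = leftWord (leftInf (σ c)) (w0Length σ) := by
  fin_cases c
  · rfl
  · simp only [w0, leftWord]
    congr 1
    refine List.map_congr_left fun t ht => ?_
    by_contra hne
    exact absurd (Nat.sInf_le (show t ∈ {i | leftInf (σ 0) i ≠ leftInf (σ 1) i} from hne))
      (not_le.2 (List.mem_range.1 ht))

/-- `W₀` is a suffix of `W₀ A` and of `W₀ B`, and the letters that precede it are different. -/
theorem exists_cons_w0_suffix {σ : Subst} (hσ : WellMarked σ) :
    ∃ γ : Fin 2 → Fin 2, Function.Injective γ ∧ ∀ c, γ c :: w0 σ <:+ w0 σ ++ σ c := by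
  refine ⟨fun c => leftInf (σ c) (w0Length σ), ?_, fun c => ?_⟩
  · have h : leftInf (σ 0) (w0Length σ) ≠ leftInf (σ 1) (w0Length σ) :=
      Nat.sInf_mem (exists_leftInf_ne hσ)
    intro c d hcd
    fin_cases c <;> fin_cases d <;> first | rfl | exact absurd hcd h | exact absurd hcd.symm h
  -- Appending σ(c) to a suffix of ⋯σ(c)σ(c) gives a longer suffix of the same word.
  · rw [w0_eq_leftWord c, ← leftWord_leftInf_add, ← leftWord_succ]
    exact leftWord_suffix _ (by have := hσ.length_pos c; omega)

theorem w0_suffix {σ : Subst} (hσ : WellMarked σ) (u : Word) : w0 σ <:+ w0 σ ++ σ.app u := by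
  obtain ⟨γ, -, hγ⟩ := exists_cons_w0_suffix hσ
  induction u with
  | nil => simp [app_nil]
  | cons c u ih =>
    rw [app_cons, ← List.append_assoc]
    exact ih.trans (suffix_append_append ((List.suffix_cons _ _).trans (hγ c)) _)

theorem w0_suffix_app {σ : Subst} (hσ : WellMarked σ) {u : Word}
    (hu : (w0 σ).length ≤ (σ.app u).length) : w0 σ <:+ σ.app u :=
  List.suffix_of_suffix_length_le (w0_suffix hσ u) (List.suffix_append _ _) hu

/-- Otherwise AB and BA would both be suffixes of W₀ and hence equal, although they begin with
different letters. -/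
theorem length_w0_lt {σ : Subst} (hσ : WellMarked σ) :
    (w0 σ).length < (σ 0).length + (σ 1).length := by
  by_contra! h
  have h1 : ∀ c d : Fin 2, (σ c).length + (σ d).length ≤ (w0 σ).length →
      σ c ++ σ d <:+ w0 σ := by
    intro c d hcd
    have := w0_suffix hσ [c, d]
    rw [app_cons, app_singleton] at this
    exact List.suffix_of_suffix_length_le (List.suffix_append _ _) this (by simpa using hcd)
  have h2 := List.suffix_of_suffix_length_le (h1 0 1 h) (h1 1 0 (by omega)) (by simp; omega)
  have h3 := h2.eq_of_length (by simp; omega)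
  obtain ⟨⟨u, hu⟩, ⟨v, hv⟩⟩ := hσ
  rw [hu, hv] at h3
  simp at h3

/-! ### The operator `T` -/

theorem opT_append (σ : Subst) (u v : Word) : opT σ (u ++ v) = opT σ u ++ σ.app v := by
  simp [opT, app_append]

theorem opT_suffix {σ : Subst} (hσ : WellMarked σ) {u v : Word} (h : u <:+ v) :
    opT σ u <:+ opT σ v := by
  obtain ⟨w, rfl⟩ := h
  rw [opT_append]
  exact suffix_append_append (w0_suffix hσ w) _

/-- T carries left extensions to left extensions, up to the permutation γ of the letters given by
the letters at which ⋯AAA and ⋯BBB first differ. -/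
theorem exists_cons_opT_suffix {σ : Subst} (hσ : WellMarked σ) :
    ∃ γ : Fin 2 → Fin 2, Function.Injective γ ∧
      ∀ (c : Fin 2) (u w : Word), γ c :: opT σ w <:+ opT σ (u ++ c :: w) := by
  obtain ⟨γ, hinj, hγ⟩ := exists_cons_w0_suffix hσ
  refine ⟨γ, hinj, fun c u w => ?_⟩
  refine List.IsSuffix.trans ?_ (opT_suffix hσ (List.suffix_append u (c :: w)))
  have := suffix_append_append (hγ c) (σ.app w)
  simpa [opT, app_cons] using this

theorem suffix_trichotomy (u v : Word) : u <:+ v ∨ v <:+ u ∨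
    ∃ (c d : Fin 2) (u' v' w : Word), c ≠ d ∧ u = u' ++ c :: w ∧ v = v' ++ d :: w := by
  induction u using List.reverseRecOn generalizing v with
  | nil => exact Or.inl (List.nil_suffix)
  | append_singleton u x ih =>
    rcases List.eq_nil_or_concat v with rfl | ⟨v, y, rfl⟩
    · exact Or.inr (Or.inl (List.nil_suffix))
    · rw [List.concat_eq_append]
      by_cases hxy : x = y
      · subst hxy
        rcases ih v with h | h | ⟨c, d, u', v', w, hcd, rfl, rfl⟩
        · exact Or.inl (suffix_append_append h _)
        · exact Or.inr (Or.inl (suffix_append_append h _))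
        · exact Or.inr (Or.inr ⟨c, d, u', v', w ++ [x], hcd, by simp, by simp⟩)
      · exact Or.inr (Or.inr ⟨x, y, u, v, [], hxy, rfl, rfl⟩)

/-- A common suffix of `T(ucW)` and `T(vdW)` with `c ≠ d` is a suffix of `T(W)`. -/
theorem suffix_opT_of_common_suffix {σ : Subst} (hσ : WellMarked σ) {c d : Fin 2} (hcd : c ≠ d)
    {u v w x : Word} (hu : x <:+ opT σ (u ++ c :: w)) (hv : x <:+ opT σ (v ++ d :: w)) :
    x <:+ opT σ w := by
  obtain ⟨γ, hinj, hγ⟩ := exists_cons_opT_suffix hσ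
  have hw : opT σ w <:+ opT σ (u ++ c :: w) := (List.suffix_cons _ _).trans (hγ c u w)
  rcases le_or_gt x.length (opT σ w).length with hle | hlt
  · exact List.suffix_of_suffix_length_le hu hw hle
  -- A longer x would end with both γ(c)T(w) and γ(d)T(w).
  · have h1 : γ c :: opT σ w <:+ x :=
      List.suffix_of_suffix_length_le (hγ c u w) hu (by simpa using hlt)
    have h2 : γ d :: opT σ w <:+ x :=
      List.suffix_of_suffix_length_le (hγ d v w) hv (by simpa using hlt)
    have h3 := (List.suffix_of_suffix_length_le h1 h2 (by simp)).eq_of_length (by simp)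
    exact absurd (hinj (List.cons.inj h3).1) hcd

theorem length_opT (σ : Subst) (w : Word) :
    (opT σ w).length = (w0 σ).length + (σ.app w).length := by
  simp [opT]

theorem two_mul_length_le_length_app {σ : Subst} (hmem : ∀ c d, d ∈ σ c) (w : Word) :
    2 * w.length ≤ (σ.app w).length := by
  induction w with
  | nil => simp
  | cons c w ih =>
    have := two_le_length hmem c
    rw [app_cons, List.length_append, List.length_cons]
    omega

theorem length_lt_length_opT {σ : Subst} (hmem : ∀ c d, d ∈ σ c) {w : Word} (hw : w ≠ []) :
    w.length < (opT σ w).length := by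
  have := two_mul_length_le_length_app hmem w
  have := List.length_pos_of_ne_nil hw
  rw [length_opT]
  omega

theorem length_opT_lt_of_suffix {σ : Subst} (hmem : ∀ c d, d ∈ σ c) {u v : Word}
    (h : u <:+ v) (hlt : u.length < v.length) : (opT σ u).length < (opT σ v).length := by
  obtain ⟨w, rfl⟩ := h
  have := two_mul_length_le_length_app hmem w
  simp only [length_opT, app_append, List.length_append] at *
  omega

/-- If `T(W)` is a suffix of `T(V)`, then `W` is a suffix of `V`. -/
theorem suffix_of_opT_suffix {σ : Subst} (hσ : WellMarked σ) (hmem : ∀ c d, d ∈ σ c)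
    {w v : Word} (h : opT σ w <:+ opT σ v) : w <:+ v := by
  rcases suffix_trichotomy w v with h' | h' | ⟨c, d, w', v', u, hcd, rfl, rfl⟩
  · exact h'
  · rcases h'.length_le.eq_or_lt with heq | hlt
    · rw [h'.eq_of_length heq]
    · exact absurd h.length_le (not_le.2 (length_opT_lt_of_suffix hmem h' hlt))
  · have h1 := (suffix_opT_of_common_suffix hσ hcd List.suffix_rfl h).length_le
    have h2 := length_opT_lt_of_suffix hmem (u := u) (v := w' ++ c :: u)
      ⟨w' ++ [c], by simp⟩ (by simp; omega)
    omega

theorem opT_injective {σ : Subst} (hσ : WellMarked σ) (hmem : ∀ c d, d ∈ σ c) :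
    Function.Injective (opT σ) := by
  intro w v h
  have h1 := suffix_of_opT_suffix hσ hmem (h ▸ List.suffix_rfl : opT σ w <:+ opT σ v)
  have h2 := suffix_of_opT_suffix hσ hmem (h ▸ List.suffix_rfl : opT σ v <:+ opT σ w)
  exact h1.eq_of_length (le_antisymm h1.length_le h2.length_le)

/-! ### Images and preimages of special words -/

/-- In an occurrence far enough to the right, the image of what precedes w is longer than W₀ and so
ends with W₀, while σ(c) begins with c. -/
theorem IsFactor.opT_append {σ : Subst} {ξ : ℕ → Fin 2} (hσ : WellMarked σ)
    (hmem : ∀ c d, d ∈ σ c) (hξ : IsFixedPoint σ ξ) {w : Word} {c : Fin 2}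
    (h : IsFactor ξ (w ++ [c])) : IsFactor ξ (opT σ w ++ [c]) := by
  obtain ⟨i, hi, hw⟩ := h.exists_ge hσ hmem hξ (w0 σ).length
  have hf : IsFactor ξ (σ.app (factorAt ξ 0 (i + (w ++ [c]).length))) := by
    rw [hξ]; exact isFactor_factorAt _ _ _
  rw [factorAt_add, zero_add, ← hw, app_append, app_append, app_singleton] at hf
  have hlen := two_mul_length_le_length_app hmem (factorAt ξ 0 i)
  rw [length_factorAt] at hlen
  obtain ⟨u, hu⟩ := w0_suffix_app hσ (u := factorAt ξ 0 i) (by omega)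
  obtain ⟨v, hv⟩ := hσ.exists_cons c
  refine hf.infix ⟨u, v, ?_⟩
  rw [← hu, hv]
  simp [opT]

theorem Special.opT {σ : Subst} {ξ : ℕ → Fin 2} (hσ : WellMarked σ) (hmem : ∀ c d, d ∈ σ c)
    (hξ : IsFixedPoint σ ξ) {w : Word} (h : Special ξ w) : Special ξ (opT σ w) :=
  ⟨h.1.opT_append hσ hmem hξ, h.2.opT_append hσ hmem hξ⟩

/-- An occurrence of `Vc` in which the position of `c` is a cutting position. -/
theorem exists_suffix_app_of_mem_cuts {σ : Subst} {ξ : ℕ → Fin 2} (hσ : WellMarked σ)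
    (hξ : IsFixedPoint σ ξ) {v : Word} {c : Fin 2} {i : ℕ}
    (hv : v ++ [c] = factorAt ξ i (v.length + 1)) (hc : i + v.length ∈ cuts σ ξ) :
    ∃ u, IsFactor ξ (u ++ [c]) ∧ v <:+ σ.app u := by
  obtain ⟨k, hk⟩ := mem_cuts_iff.1 hc
  rw [factorAt_succ] at hv
  obtain ⟨hv1, hv2⟩ := List.append_inj hv (by simp [length_factorAt])
  refine ⟨factorAt ξ 0 k, ?_, ?_⟩
  · have : c = ξ (0 + k) := by
      rw [zero_add, ← apply_cutPos hσ hξ, hk]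
      simpa using hv2
    rw [this, ← factorAt_succ]
    exact isFactor_factorAt _ _ _
  · rw [hξ k]
    change v <:+ factorAt ξ 0 (cutPos σ ξ k)
    rw [hk, factorAt_add, zero_add, ← hv1]
    exact List.suffix_append _ _

/-- A long special word is a suffix of `T(W)` for a special word `W`. -/
theorem Special.exists_suffix_opT {σ : Subst} {ξ : ℕ → Fin 2} (hσ : WellMarked σ)
    (hξ : IsFixedPoint σ ξ) {C : ℕ} (hC : IsRecogConst σ ξ C)
    {v : Word} (h : Special ξ v) (hv : 2 * C + maxLen σ ≤ v.length) :
    ∃ w, Special ξ w ∧ v <:+ BinSubst.opT σ w := by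
  obtain ⟨⟨i, hi⟩, ⟨j, hj⟩⟩ := h
  rw [List.length_append, List.length_singleton] at hi hj
  have hi' := hi
  have hj' := hj
  rw [factorAt_succ] at hi' hj'
  obtain ⟨hi1, hi2⟩ := List.append_inj hi' (by simp [length_factorAt])
  obtain ⟨hj1, hj2⟩ := List.append_inj hj' (by simp [length_factorAt])
  have heq := (factorAt_eq_iff ξ i j v.length).1 (hi1.symm.trans hj1)
  have hcut : i + v.length ∈ cuts σ ξ ∧ j + v.length ∈ cuts σ ξ := by
    -- A cut of the first occurrence with C letters of v on its left and at least C + 1 from it on: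
    -- recognizability makes it common to both occurrences.
    obtain ⟨k, hk, hk'⟩ := exists_cutPos_mem_Ico hσ ξ (i + C)
    obtain ⟨t, ht⟩ := Nat.exists_eq_add_of_le hk
    have hit : (i + t) + C ∈ cuts σ ξ := by
      rw [show i + t + C = cutPos σ ξ k by omega]; exact cutPos_mem_cuts σ ξ k
    have hjt := hC (i + t) (j + t) ((factorAt_eq_iff _ _ _ _).2 fun s hs => by
      rw [add_assoc, add_assoc]; exact heq _ (by omega)) hit
    obtain ⟨h1, h2⟩ := common_cut_propagates hσ hξ heq (t := t + C) (by omega)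
      (by rwa [← add_assoc]) (by rwa [← add_assoc])
    -- Inside a common block the two occurrences would continue with the same letter, but one
    -- continues with a and the other with b.
    have h3 : i + v.length ∈ cuts σ ξ := by
      by_contra h3
      have := h2 h3
      simp only [List.cons.injEq, and_true] at hi2 hj2
      rw [← hi2, ← hj2] at this
      exact absurd this (by decide)
    exact ⟨h3, h1.1 h3⟩
  obtain ⟨u, hu, hvu⟩ := exists_suffix_app_of_mem_cuts hσ hξ hi hcut.1
  obtain ⟨u', hu', hvu'⟩ := exists_suffix_app_of_mem_cuts hσ hξ hj hcut.2
  have hT : v <:+ BinSubst.opT σ u := hvu.trans (List.suffix_append _ _)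
  have hT' : v <:+ BinSubst.opT σ u' := hvu'.trans (List.suffix_append _ _)
  rcases suffix_trichotomy u u' with ⟨x, rfl⟩ | ⟨x, rfl⟩ | ⟨c, d, x, x', w, hcd, rfl, rfl⟩
  · exact ⟨u, ⟨hu, hu'.infix ⟨x, [], by simp⟩⟩, hT⟩
  · exact ⟨u', ⟨hu.infix ⟨x, [], by simp⟩, hu'⟩, hT'⟩
  · exact ⟨w, ⟨hu.infix ⟨x ++ [c], [], by simp⟩, hu'.infix ⟨x' ++ [d], [], by simp⟩⟩,
      suffix_opT_of_common_suffix hσ hcd hT hT'⟩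

theorem StrongSpecial.opT {σ : Subst} {ξ : ℕ → Fin 2} (hσ : WellMarked σ)
    (hmem : ∀ c d, d ∈ σ c) (hξ : IsFixedPoint σ ξ) {w : Word} (h : StrongSpecial ξ w) :
    StrongSpecial ξ (opT σ w) := by
  obtain ⟨γ, hinj, hγ⟩ := exists_cons_opT_suffix hσ
  have hs : ∀ d, Special ξ (d :: BinSubst.opT σ w) := by
    intro d
    obtain ⟨c, rfl⟩ := (Finite.injective_iff_surjective.1 hinj) d
    have hc : Special ξ (c :: w) := by
      fin_cases c
      · exact h.2.1
      · exact h.2.2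
    exact (hc.opT hσ hmem hξ).suffix (hγ c [] w)
  exact ⟨h.1.opT hσ hmem hξ, hs 0, hs 1⟩

theorem WeakSpecial.not_special_cons {ξ : ℕ → Fin 2} {w : Word} (h : WeakSpecial ξ w)
    (c : Fin 2) : ¬ Special ξ (c :: w) := by
  fin_cases c
  · exact h.2.1
  · exact h.2.2

/-- A special left extension of T(w) would desubstitute to a special word properly ending with w.
The length bound is what permits desubstitution. -/
theorem WeakSpecial.opT {σ : Subst} {ξ : ℕ → Fin 2} (hσ : WellMarked σ)
    (hmem : ∀ c d, d ∈ σ c) (hξ : IsFixedPoint σ ξ) {C : ℕ} (hC : IsRecogConst σ ξ C)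
    {w : Word} (h : WeakSpecial ξ w) (hlen : 2 * C + maxLen σ ≤ (opT σ w).length) :
    WeakSpecial ξ (opT σ w) := by
  have hs : ∀ d, ¬ Special ξ (d :: BinSubst.opT σ w) := by
    intro d hd
    obtain ⟨v, hv, hsuf⟩ := hd.exists_suffix_opT hσ hξ hC (by rw [List.length_cons]; omega)
    obtain ⟨x, rfl⟩ := suffix_of_opT_suffix hσ hmem ((List.suffix_cons _ _).trans hsuf)
    rcases List.eq_nil_or_concat x with rfl | ⟨x, c, rfl⟩
    · have := hsuf.length_le
      simp at this
    · exact h.not_special_cons c (hv.suffix ⟨x, by simp⟩)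
  exact ⟨h.1.opT hσ hmem hξ, hs 0, hs 1⟩

/-- As v is a suffix of a special word T(w), a proper suffix would have a special left extension. -/
theorem WeakSpecial.exists_eq_opT {σ : Subst} {ξ : ℕ → Fin 2} (hσ : WellMarked σ)
    (hmem : ∀ c d, d ∈ σ c) (hξ : IsFixedPoint σ ξ) {C : ℕ} (hC : IsRecogConst σ ξ C)
    {v : Word} (h : WeakSpecial ξ v) (hlen : 2 * C + maxLen σ ≤ v.length) :
    ∃ w, v = BinSubst.opT σ w ∧ WeakSpecial ξ w := by
  obtain ⟨w, hw, x, hx⟩ := h.1.exists_suffix_opT hσ hξ hC hlen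
  have hTw := hw.opT hσ hmem hξ
  have hvw : v = BinSubst.opT σ w := by
    rcases List.eq_nil_or_concat x with rfl | ⟨x, c, rfl⟩
    · simpa using hx
    · exact absurd (hTw.suffix ⟨x, by simpa using hx⟩) (h.not_special_cons c)
  refine ⟨w, hvw, ?_⟩
  obtain ⟨γ, -, hγ⟩ := exists_cons_opT_suffix hσ
  have hs : ∀ c, ¬ Special ξ (c :: w) := fun c hc =>
    h.not_special_cons (γ c) (hvw ▸ (hc.opT hσ hmem hξ).suffix (hγ c [] w))
  exact ⟨hw, hs 0, hs 1⟩

/-- The preimages of 0v and 1v cannot be suffixes of each other, so they branch to the left of a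
common suffix w, which is strong. Were v shorter than T(w), both 0v and 1v would be suffixes of
T(w). -/
theorem StrongSpecial.exists_eq_opT {σ : Subst} {ξ : ℕ → Fin 2} (hσ : WellMarked σ)
    (hξ : IsFixedPoint σ ξ) {C : ℕ} (hC : IsRecogConst σ ξ C)
    {v : Word} (h : StrongSpecial ξ v) (hlen : 2 * C + maxLen σ ≤ v.length) :
    ∃ w, v = BinSubst.opT σ w ∧ StrongSpecial ξ w := by
  obtain ⟨u, hu, hsu⟩ := h.2.1.exists_suffix_opT hσ hξ hC (by rw [List.length_cons]; omega)
  obtain ⟨u', hu', hsu'⟩ := h.2.2.exists_suffix_opT hσ hξ hC (by rw [List.length_cons]; omega)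
  have hne : ∀ {x : Word}, 0 :: v <:+ x → 1 :: v <:+ x → False := fun h0 h1 => by
    have := (List.suffix_of_suffix_length_le h0 h1 (by simp)).eq_of_length (by simp)
    simp at this
  rcases suffix_trichotomy u u' with hs | hs | ⟨c, d, x, x', w, hcd, rfl, rfl⟩
  · exact (hne (hsu.trans (opT_suffix hσ hs)) hsu').elim
  · exact (hne hsu (hsu'.trans (opT_suffix hσ hs))).elim
  · have h1 : v <:+ BinSubst.opT σ w := suffix_opT_of_common_suffix hσ hcd
      ((List.suffix_cons _ _).trans hsu) ((List.suffix_cons _ _).trans hsu')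
    obtain ⟨γ, -, hγ⟩ := exists_cons_opT_suffix hσ
    have hw : ∀ e, Special ξ (e :: w) := by
      intro e
      have : e = c ∨ e = d := by omega
      rcases this with rfl | rfl
      · exact hu.suffix ⟨x, rfl⟩
      · exact hu'.suffix ⟨x', rfl⟩
    refine ⟨w, ?_, (hw 0).suffix (List.suffix_cons _ _), hw 0, hw 1⟩
    by_contra hvw
    have hlt : v.length < (BinSubst.opT σ w).length :=
      lt_of_le_of_ne h1.length_le fun heq => hvw (h1.eq_of_length heq)
    have h2 := List.suffix_of_suffix_length_le hsu
      ((List.suffix_cons _ _).trans (hγ c x w)) (by simpa using hlt)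
    have h3 := List.suffix_of_suffix_length_le hsu'
      ((List.suffix_cons _ _).trans (hγ d x' w)) (by simpa using hlt)
    exact hne h2 h3

/-! ### Counting factors and special words -/

theorem finite_setOf_length_eq (Q : Word → Prop) (n : ℕ) : {w | Q w ∧ w.length = n}.Finite :=
  (List.finite_length_eq (Fin 2) n).subset fun _ hw => hw.2

/-- The map `f` adjoins a letter: on the right when factors are counted, on the left when special
words are. -/
theorem ncard_length_succ (f : Fin 2 → Word → Word)
    (hf : ∀ c d u v, f c u = f d v → c = d ∧ u = v) (hlen : ∀ c u, (f c u).length = u.length + 1)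
    (hsurj : ∀ w : Word, w ≠ [] → ∃ c u, f c u = w) (Q : Word → Prop) (n : ℕ) :
    {w | Q w ∧ w.length = n + 1}.ncard =
      {w | Q (f 0 w) ∧ w.length = n}.ncard + {w | Q (f 1 w) ∧ w.length = n}.ncard := by
  have himg : {w | Q w ∧ w.length = n + 1} =
      f 0 '' {w | Q (f 0 w) ∧ w.length = n} ∪ f 1 '' {w | Q (f 1 w) ∧ w.length = n} := by
    ext w
    constructor
    · rintro ⟨hQ, hw⟩
      obtain ⟨c, u, rfl⟩ := hsurj w (by rintro rfl; simp at hw)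
      rw [hlen] at hw
      fin_cases c
      · exact Or.inl ⟨u, ⟨hQ, by omega⟩, rfl⟩
      · exact Or.inr ⟨u, ⟨hQ, by omega⟩, rfl⟩
    · rintro (⟨u, ⟨hQ, hu⟩, rfl⟩ | ⟨u, ⟨hQ, hu⟩, rfl⟩)
      · exact ⟨hQ, by rw [hlen, hu]⟩
      · exact ⟨hQ, by rw [hlen, hu]⟩
  have hinj : ∀ c, Function.Injective (f c) := fun c u v h => (hf c c u v h).2
  rw [himg, Set.ncard_union_eq ?_ ((finite_setOf_length_eq _ n).image _)
    ((finite_setOf_length_eq _ n).image _), Set.ncard_image_of_injective _ (hinj 0),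
    Set.ncard_image_of_injective _ (hinj 1)]
  · rw [Set.disjoint_left]
    rintro _ ⟨u, -, rfl⟩ ⟨v, -, h⟩
    exact absurd (hf 1 0 v u h).1 (by decide)

theorem ncard_or_add_ncard_and (Q R : Word → Prop) (n : ℕ) :
    {w | (Q w ∨ R w) ∧ w.length = n}.ncard + {w | (Q w ∧ R w) ∧ w.length = n}.ncard =
      {w | Q w ∧ w.length = n}.ncard + {w | R w ∧ w.length = n}.ncard := by
  rw [← Set.ncard_union_add_ncard_inter _ _ (finite_setOf_length_eq Q n)
    (finite_setOf_length_eq R n)]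
  congr 2 <;> ext w <;> simp only [Set.mem_union, Set.mem_inter_iff, Set.mem_ofPred_eq] <;> tauto

theorem isFactor_iff_exists_append {ξ : ℕ → Fin 2} {w : Word} :
    IsFactor ξ w ↔ IsFactor ξ (w ++ [0]) ∨ IsFactor ξ (w ++ [1]) := by
  constructor
  · rintro ⟨i, hi⟩
    have h : IsFactor ξ (w ++ [ξ (i + w.length)]) := ⟨i, by
      rw [List.length_append, List.length_singleton, factorAt_succ, ← hi]⟩
    generalize ξ (i + w.length) = c at h
    fin_cases c
    · exact Or.inl h
    · exact Or.inr h
  · rintro (h | h)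
    · exact h.infix ⟨[], [0], by simp⟩
    · exact h.infix ⟨[], [1], by simp⟩

/-- The special words count the increments of the complexity. -/
theorem complexity_succ (ξ : ℕ → Fin 2) (n : ℕ) :
    complexity ξ (n + 1) = complexity ξ n + specialCount ξ n := by
  rw [complexity, ncard_length_succ (fun c w => w ++ [c]), ← ncard_or_add_ncard_and]
  · congr 1
    rw [complexity]
    congr 1
    ext w
    exact and_congr_left fun _ => isFactor_iff_exists_append.symm
  · intro c d u v h
    obtain ⟨h1, h2⟩ := List.append_inj' h rfl
    exact ⟨by simpa using h2, h1⟩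
  · simp
  · intro w hw
    exact ⟨_, _, List.dropLast_append_getLast hw⟩

/-- The numbers of strong and of weak special words count the increments of `s`. -/
theorem specialCount_succ (ξ : ℕ → Fin 2) (n : ℕ) :
    (specialCount ξ (n + 1) : ℤ) - specialCount ξ n =
      {w | StrongSpecial ξ w ∧ w.length = n}.ncard -
        {w | WeakSpecial ξ w ∧ w.length = n}.ncard := by
  have h1 : specialCount ξ (n + 1) = {w | Special ξ (0 :: w) ∧ w.length = n}.ncard +
      {w | Special ξ (1 :: w) ∧ w.length = n}.ncard := by
    refine ncard_length_succ (fun c w => c :: w) ?_ ?_ ?_ _ n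
    · intro c d u v h
      exact List.cons.inj h
    · simp
    · intro w hw
      exact ⟨_, _, List.cons_head_tail hw⟩
  rw [← ncard_or_add_ncard_and] at h1
  have h2 := ncard_or_add_ncard_and
    (fun w => Special ξ (0 :: w) ∨ Special ξ (1 :: w)) (WeakSpecial ξ) n
  have h3 : {w | ((Special ξ (0 :: w) ∨ Special ξ (1 :: w)) ∧ WeakSpecial ξ w) ∧
      w.length = n} = ∅ := by
    ext w
    simp only [WeakSpecial, Set.mem_ofPred_eq, Set.mem_empty_iff_false]
    tauto
  have h4 : {w | ((Special ξ (0 :: w) ∨ Special ξ (1 :: w)) ∨ WeakSpecial ξ w) ∧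
      w.length = n} = {w | Special ξ w ∧ w.length = n} := by
    ext w
    have h0 : Special ξ (0 :: w) → Special ξ w := fun h => h.suffix (List.suffix_cons _ _)
    have h1 : Special ξ (1 :: w) → Special ξ w := fun h => h.suffix (List.suffix_cons _ _)
    simp only [WeakSpecial, Set.mem_ofPred_eq]
    tauto
  have h5 : {w | (Special ξ (0 :: w) ∧ Special ξ (1 :: w)) ∧ w.length = n} =
      {w | StrongSpecial ξ w ∧ w.length = n} := by
    ext w
    have h0 : Special ξ (0 :: w) → Special ξ w := fun h => h.suffix (List.suffix_cons _ _)
    simp only [StrongSpecial, Set.mem_ofPred_eq]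
    tauto
  rw [h3, h4, Set.ncard_empty] at h2
  rw [h5] at h1
  change specialCount ξ n + 0 = _ at h2
  omega

/-! ### Orbits of the operator `T` -/

/-- `|T^n(W)|`. -/
noncomputable def orbitLength (σ : Subst) (w : Word) (n : ℕ) : ℕ := ((opT σ)^[n] w).length

theorem opT_ne_nil {σ : Subst} (hmem : ∀ c d, d ∈ σ c) {w : Word} (hw : w ≠ []) :
    opT σ w ≠ [] := by
  have := length_lt_length_opT hmem hw
  exact List.ne_nil_of_length_pos (by omega)

theorem iterate_opT_ne_nil {σ : Subst} (hmem : ∀ c d, d ∈ σ c) {w : Word} (hw : w ≠ [])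
    (n : ℕ) : (opT σ)^[n] w ≠ [] := by
  induction n with
  | zero => exact hw
  | succ n ih => rw [Function.iterate_succ_apply']; exact opT_ne_nil hmem ih

theorem strictMono_orbitLength {σ : Subst} (hmem : ∀ c d, d ∈ σ c) {w : Word} (hw : w ≠ []) :
    StrictMono (orbitLength σ w) :=
  strictMono_nat_of_lt_succ fun n => by
    rw [orbitLength, orbitLength, Function.iterate_succ_apply']
    exact length_lt_length_opT hmem (iterate_opT_ne_nil hmem hw n)

/-- Words longer than `L` with a property that is transported by `T` are counted by the orbits
of the words of length at most `L`. -/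
theorem ncard_eq_ncard_orbit {σ : Subst} (hσ : WellMarked σ) (hmem : ∀ c d, d ∈ σ c) {L : ℕ}
    (hL : (w0 σ).length ≤ L) {Q : Word → Prop}
    (hdown : ∀ v, Q v → L < v.length → ∃ w, v = opT σ w ∧ Q w)
    (hup : ∀ w, Q w → L < (opT σ w).length → Q (opT σ w)) {n : ℕ} (hn : L < n) :
    {w | Q w ∧ w.length = n}.ncard =
      {w | (Q w ∧ 1 ≤ w.length ∧ w.length ≤ L ∧ L < (opT σ w).length) ∧
        ∃ m, orbitLength σ w m = n}.ncard := by
  symm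
  have hup' : ∀ w, Q w → 1 ≤ w.length → L < (opT σ w).length → ∀ m, Q ((opT σ)^[m] w) := by
    intro w hw h1 hl m
    have hne : w ≠ [] := List.ne_nil_of_length_pos h1
    induction m with
    | zero => exact hw
    | succ m ih =>
      have h2 := (strictMono_orbitLength hmem hne).monotone (show 1 ≤ m + 1 by omega)
      rw [orbitLength, orbitLength, Function.iterate_succ_apply' _ m] at h2
      rw [Function.iterate_succ_apply']
      exact hup _ ih (lt_of_lt_of_le hl h2)
  -- Orbits of distinct initial words are disjoint: cancelling T by injectivity leaves a = T^k(b),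
  -- which is longer than L unless k = 0.
  have hlow : ∀ {a b : Word} {m k : ℕ}, b ≠ [] → a.length ≤ L → L < (opT σ b).length →
      (opT σ)^[m] a = (opT σ)^[m + k] b → a = b := by
    intro a b m k hb ha hbl h
    rw [Function.iterate_add_apply] at h
    have h' := (opT_injective hσ hmem).iterate m h
    rcases k with _ | k
    · exact h'
    · have h2 := (strictMono_orbitLength hmem hb).monotone (show 1 ≤ k + 1 by omega)
      rw [orbitLength, orbitLength, ← h'] at h2
      exact absurd (lt_of_lt_of_le hbl h2) (not_lt.2 ha)
  refine Set.ncard_congr (fun w hw => (opT σ)^[hw.2.choose] w) ?_ ?_ ?_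
  · rintro w ⟨⟨hQ, h1, -, hl⟩, hm⟩
    exact ⟨hup' w hQ h1 hl _, Exists.choose_spec (p := fun m => orbitLength σ w m = n) hm⟩
  · rintro a b ⟨⟨_, ha1, ha2, ha3⟩, hma⟩ ⟨⟨_, hb1, hb2, hb3⟩, hmb⟩ h
    change (opT σ)^[hma.choose] a = (opT σ)^[hmb.choose] b at h
    rcases le_total hma.choose hmb.choose with hle | hle
    · obtain ⟨k, hk⟩ := Nat.exists_eq_add_of_le hle
      exact hlow (List.ne_nil_of_length_pos hb1) ha2 hb3 (h.trans (by rw [hk]))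
    · obtain ⟨k, hk⟩ := Nat.exists_eq_add_of_le hle
      exact (hlow (List.ne_nil_of_length_pos ha1) hb2 ha3 (h.symm.trans (by rw [hk]))).symm
  · have hex : ∀ v, Q v → L < v.length → ∃ w m,
        (Q w ∧ 1 ≤ w.length ∧ w.length ≤ L ∧ L < (opT σ w).length) ∧ (opT σ)^[m] w = v := by
      intro v
      induction hk : v.length using Nat.strong_induction_on generalizing v with
      | _ k ih =>
      intro hQ hv
      obtain ⟨w, rfl, hw⟩ := hdown v hQ (hk ▸ hv)
      -- T of the empty word is W₀, whose length is at most L.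
      have hne : w ≠ [] := by
        rintro rfl
        rw [length_opT, app_nil, List.length_nil] at hk
        omega
      have hlt := length_lt_length_opT hmem hne
      by_cases hwL : w.length ≤ L
      · exact ⟨w, 1, ⟨hw, List.length_pos_of_ne_nil hne, hwL, hk ▸ hv⟩, rfl⟩
      · obtain ⟨u, m, hu, rfl⟩ := ih _ (by omega) w rfl hw (by omega)
        exact ⟨u, m + 1, hu, Function.iterate_succ_apply' _ _ _⟩
    rintro v ⟨hQ, hv⟩
    obtain ⟨w, m, hw, rfl⟩ := hex v hQ (by omega)
    refine ⟨w, ⟨hw, m, hv⟩, ?_⟩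
    congr 1
    refine (strictMono_orbitLength hmem (List.ne_nil_of_length_pos hw.2.1)).injective ?_
    exact (Exists.choose_spec (p := fun m => orbitLength σ w m = n) ⟨m, hv⟩).trans hv.symm

/-- This is the purpose of the term |A| + |B| - 1 in L. -/
theorem w0_length_le_bigL {σ : Subst} (hσ : WellMarked σ) (C : ℕ) :
    (w0 σ).length ≤ bigL σ C := by
  have := length_w0_lt hσ
  rw [bigL]
  omega

theorem le_bigL (σ : Subst) (C : ℕ) : 2 * C + maxLen σ ≤ bigL σ C := le_max_left _ _

/-- Beyond `L`, the increments of `s` are counted by the orbits of the initial special words. -/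
theorem specialCount_succ_sub {σ : Subst} {ξ : ℕ → Fin 2} (hσ : WellMarked σ)
    (hmem : ∀ c d, d ∈ σ c) (hξ : IsFixedPoint σ ξ) {C : ℕ} (hC : IsRecogConst σ ξ C)
    {n : ℕ} (hn : bigL σ C < n) :
    (specialCount ξ (n + 1) : ℤ) - specialCount ξ n =
      {w ∈ initStrong σ ξ C | ∃ m, orbitLength σ w m = n}.ncard -
        {w ∈ initWeak σ ξ C | ∃ m, orbitLength σ w m = n}.ncard := by
  have hL := le_bigL σ C
  rw [specialCount_succ,
    ncard_eq_ncard_orbit hσ hmem (w0_length_le_bigL hσ C) (Q := StrongSpecial ξ)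
      (fun v hv hl => hv.exists_eq_opT hσ hξ hC (by omega))
      (fun w hw _ => hw.opT hσ hmem hξ) hn,
    ncard_eq_ncard_orbit hσ hmem (w0_length_le_bigL hσ C) (Q := WeakSpecial ξ)
      (fun v hv hl => hv.exists_eq_opT hσ hmem hξ hC (by omega))
      (fun w hw hl => hw.opT hσ hmem hξ hC (by omega)) hn]
  rfl

theorem specialCount_succ_of_initSpecial_eq_empty {σ : Subst} {ξ : ℕ → Fin 2}
    (hσ : WellMarked σ) (hmem : ∀ c d, d ∈ σ c) (hξ : IsFixedPoint σ ξ) {C : ℕ}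
    (hC : IsRecogConst σ ξ C) (hE : initSpecial σ ξ C = ∅) {n : ℕ} (hn : bigL σ C < n) :
    specialCount ξ (n + 1) = specialCount ξ n := by
  have h := specialCount_succ_sub hσ hmem hξ hC hn
  obtain ⟨h1, h2⟩ := Set.union_empty_iff.1 hE
  simp only [h1, h2, Set.mem_empty_iff_false, false_and, Set.ofPred_false, Set.ncard_empty] at h
  omega

theorem finite_initSpecial (σ : Subst) (ξ : ℕ → Fin 2) (C : ℕ) : (initSpecial σ ξ C).Finite := by
  refine (List.finite_length_le (Fin 2) (bigL σ C)).subset ?_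
  rintro w (hw | hw)
  · exact hw.2.2.1
  · exact hw.2.2.1

theorem ne_nil_of_mem_initSpecial {σ : Subst} {ξ : ℕ → Fin 2} {C : ℕ} {w : Word}
    (hw : w ∈ initSpecial σ ξ C) : w ≠ [] := by
  rcases hw with hw | hw
  · exact List.ne_nil_of_length_pos hw.2.1
  · exact List.ne_nil_of_length_pos hw.2.1

theorem bigL_lt_of_mem_initSpecial {σ : Subst} {ξ : ℕ → Fin 2} {C : ℕ} {w : Word}
    (hw : w ∈ initSpecial σ ξ C) : bigL σ C < (opT σ w).length := by
  rcases hw with hw | hw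
  · exact hw.2.2.2
  · exact hw.2.2.2

open Classical in
/-- Beyond `L`, the increments of `s` as a sum over an enumeration of the initial special words. -/
theorem specialCount_succ_sub_eq_sum {σ : Subst} {ξ : ℕ → Fin 2} (hσ : WellMarked σ)
    (hmem : ∀ c d, d ∈ σ c) (hξ : IsFixedPoint σ ξ) {C : ℕ} (hC : IsRecogConst σ ξ C)
    {K : ℕ} {S : ℕ → Word} (hS : Set.BijOn S (Set.Icc 1 K) (initSpecial σ ξ C))
    {n : ℕ} (hn : bigL σ C < n) :
    (specialCount ξ (n + 1) : ℤ) - specialCount ξ n =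
      ∑ i ∈ Finset.Icc 1 K, if ∃ m, orbitLength σ (S i) m = n then sgn σ ξ C (S i) else 0 := by
  set F := (finite_initSpecial σ ξ C).toFinset
  have hF : ∀ w, w ∈ F ↔ w ∈ initSpecial σ ξ C := fun w => Set.Finite.mem_toFinset _
  have hsum : ∑ i ∈ Finset.Icc 1 K,
      (if ∃ m, orbitLength σ (S i) m = n then sgn σ ξ C (S i) else 0) =
      ∑ w ∈ F, if ∃ m, orbitLength σ w m = n then sgn σ ξ C w else 0 := by
    refine Finset.sum_nbij S (fun i hi => (hF _).2 (hS.mapsTo (by simpa using hi))) ?_ ?_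
      (fun _ _ => rfl)
    · simpa using hS.injOn
    · simpa [F] using hS.surjOn
  have hcount : ∀ A : Set Word, A ⊆ initSpecial σ ξ C →
      ({w ∈ A | ∃ m, orbitLength σ w m = n}.ncard : ℤ) =
        ∑ w ∈ F, if w ∈ A ∧ ∃ m, orbitLength σ w m = n then 1 else 0 := by
    intro A hA
    rw [Finset.sum_boole, ← Set.ncard_coe_finset]
    congr 2
    ext w
    simp only [Set.mem_ofPred_eq, Finset.coe_filter, hF]
    exact ⟨fun h => ⟨hA h.1, h⟩, fun h => h.2⟩
  rw [specialCount_succ_sub hσ hmem hξ hC hn, hsum, hcount _ Set.subset_union_right,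
    hcount _ Set.subset_union_left, ← Finset.sum_sub_distrib]
  refine Finset.sum_congr rfl fun w hw => ?_
  have hexcl : w ∈ initWeak σ ξ C → w ∉ initStrong σ ξ C := fun h h' => h.1.2.1 h'.1.2.1
  by_cases hm : ∃ m, orbitLength σ w m = n
  · by_cases hweak : w ∈ initWeak σ ξ C
    · simp [sgn, hm, hweak, hexcl hweak]
    · simp [sgn, hm, hweak]
  · simp [hm]

/-! ### Lengths of the iterates of `T` -/

theorem length_eq_count_add_count (w : Word) : w.length = w.count 0 + w.count 1 := by
  induction w with
  | nil => rfl
  | cons c w ih => fin_cases c <;> simp [ih] <;> omega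

theorem count_app (σ : Subst) (w : Word) (d : Fin 2) :
    (σ.app w).count d = w.count 0 * (σ 0).count d + w.count 1 * (σ 1).count d := by
  induction w with
  | nil => simp [app_nil]
  | cons c w ih =>
    rw [app_cons, List.count_append, ih]
    fin_cases c <;> simp <;> ring

theorem count_opT (σ : Subst) (w : Word) (d : Fin 2) : (opT σ w).count d =
    (w0 σ).count d + (w.count 0 * (σ 0).count d + w.count 1 * (σ 1).count d) := by
  rw [opT, List.count_append, count_app]

theorem orbitLength_iterate (σ : Subst) (w : Word) (m n : ℕ) :
    orbitLength σ ((opT σ)^[m] w) n = orbitLength σ w (m + n) := by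
  rw [orbitLength, orbitLength, ← Function.iterate_add_apply, add_comm]

/-- On Parikh vectors T is the affine map x ↦ Mx + w with w the vector of W₀. Cayley–Hamilton
removes the linear part, and Mw + w - tr(M)w remains. -/
theorem orbitLength_add_two (σ : Subst) (w : Word) (n : ℕ) :
    (orbitLength σ w (n + 2) : ℤ) =
      (incidence σ).trace * orbitLength σ w (n + 1) - (incidence σ).det * orbitLength σ w n +
        (((σ.app (w0 σ)).length : ℤ) - ((incidence σ).trace - 1) * (w0 σ).length) := by
  simp only [orbitLength, Function.iterate_succ_apply']
  generalize (opT σ)^[n] w = u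
  simp only [length_eq_count_add_count, count_opT, count_app, Matrix.trace_fin_two,
    Matrix.det_fin_two, incidence, Matrix.of_apply]
  push_cast
  ring

theorem lengthRecurrence_pointN (σ : Subst) (S : ℕ → Word) (e : ℕ → ℕ) (k : ℕ) :
    LengthRecurrence σ (pointN σ S e k) := by
  intro j
  have h := orbitLength_add_two σ (S k) (j + e k)
  rw [add_right_comm j (e k) 2, add_right_comm j (e k) 1] at h
  exact h

/-- The comparison is made letter by letter, since T need not preserve inequalities between lengths.
-/
theorem count_iterate_opT_mono {σ : Subst} {u v : Word} (h : ∀ d, u.count d ≤ v.count d)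
    (n : ℕ) (d : Fin 2) : ((opT σ)^[n] u).count d ≤ ((opT σ)^[n] v).count d := by
  induction n generalizing d with
  | zero => exact h d
  | succ n ih =>
    rw [Function.iterate_succ_apply', Function.iterate_succ_apply', count_opT, count_opT]
    gcongr
    · exact ih 0
    · exact ih 1

theorem length_le_count_opT {σ : Subst} (hmem : ∀ c d, d ∈ σ c) (w : Word) (d : Fin 2) :
    w.length ≤ (opT σ w).count d := by
  have h0 := Nat.le_mul_of_pos_right (w.count 0) (List.count_pos_iff.2 (hmem 0 d))
  have h1 := Nat.le_mul_of_pos_right (w.count 1) (List.count_pos_iff.2 (hmem 1 d))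
  rw [count_opT, length_eq_count_add_count]
  omega

/-- A shift of the lengths of the iterates on `v` dominates the lengths of the iterates on `u`. -/
theorem exists_orbitLength_le {σ : Subst} (hmem : ∀ c d, d ∈ σ c) (u : Word) {v : Word}
    (hv : v ≠ []) : ∃ m, ∀ n, orbitLength σ u n ≤ orbitLength σ v (m + n) := by
  -- After |u| iterations v has grown to length at least |u|; one more puts at least |u| copies of
  -- each letter into it.
  refine ⟨u.length + 1, fun n => ?_⟩
  have hcount : ∀ d, u.count d ≤ ((opT σ)^[u.length + 1] v).count d := by
    intro d
    rw [Function.iterate_succ_apply']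
    calc u.count d ≤ u.length := List.count_le_length
      _ ≤ orbitLength σ v u.length := (strictMono_orbitLength hmem hv).le_apply
      _ ≤ _ := length_le_count_opT hmem _ d
  rw [← orbitLength_iterate, orbitLength, orbitLength, length_eq_count_add_count,
    length_eq_count_add_count ((opT σ)^[n] ((opT σ)^[u.length + 1] v))]
  exact Nat.add_le_add (count_iterate_opT_mono hcount n 0) (count_iterate_opT_mono hcount n 1)

/-! ### Synchronization -/

/-- The terms of a binary recurrence with real characteristic roots `a > b ≥ 0` have eventually
constant sign. -/
theorem eventually_sign_of_recurrence {a b : ℝ} (hb : 0 ≤ b) (hab : b < a) {d : ℕ → ℝ}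
    (hd : ∀ n, d (n + 2) = (a + b) * d (n + 1) - a * b * d n) :
    ∃ N, (∀ n, N ≤ n → d n < 0) ∨ (∀ n, N ≤ n → d n = 0) ∨ ∀ n, N ≤ n → 0 < d n := by
  have ha : 0 < a := hb.trans_lt hab
  -- Each of the two first-order differences is geometric; eliminating d(n+1) between them gives the
  -- closed form.
  have hu : ∀ n, d (n + 1) - b * d n = (d 1 - b * d 0) * a ^ n := by
    intro n
    induction n with
    | zero => simp
    | succ n ih => rw [pow_succ, ← mul_assoc, ← ih, hd]; ring
  have hv : ∀ n, d (n + 1) - a * d n = (d 1 - a * d 0) * b ^ n := by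
    intro n
    induction n with
    | zero => simp
    | succ n ih => rw [pow_succ, ← mul_assoc, ← ih, hd]; ring
  generalize d 1 - b * d 0 = u at hu
  generalize d 1 - a * d 0 = v at hv
  have hclosed : ∀ n, (a - b) * d n = u * a ^ n - v * b ^ n := fun n => by
    linear_combination hu n - hv n
  have hpos : 0 < a - b := sub_pos.2 hab
  have hneg : ∀ n, (a - b) * d n < 0 → d n < 0 := fun n h => by
    by_contra hc
    exact absurd (mul_nonneg hpos.le (not_lt.1 hc)) (not_le.2 h)
  rcases eq_or_ne u 0 with rfl | hu0
  -- Only the power of b is left. For b = 0 it vanishes from n = 1 on; for b > 0 it has constant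
  -- sign.
  · rcases hb.eq_or_lt with rfl | hb
    · refine ⟨1, Or.inr (Or.inl fun n hn => ?_)⟩
      have := hclosed n
      rw [zero_pow (by omega)] at this
      simpa [ha.ne'] using this
    · refine ⟨0, ?_⟩
      rcases lt_trichotomy v 0 with h | rfl | h
      · refine Or.inr (Or.inr fun n _ => pos_of_mul_pos_right (a := a - b) ?_ hpos.le)
        rw [hclosed]
        have := mul_neg_of_neg_of_pos h (pow_pos hb n)
        linarith
      · refine Or.inr (Or.inl fun n _ => ?_)
        have := hclosed n
        simpa [hpos.ne'] using this
      · refine Or.inl fun n _ => hneg n ?_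
        rw [hclosed]
        have := mul_pos h (pow_pos hb n)
        linarith
  · have hlim : Filter.Tendsto (fun n : ℕ => |v| * (b / a) ^ n) Filter.atTop (nhds (|v| * 0)) :=
      (tendsto_pow_atTop_nhds_zero_of_lt_one (div_nonneg hb ha.le)
        ((div_lt_one ha).2 hab)).const_mul _
    rw [mul_zero] at hlim
    obtain ⟨N, hN⟩ := Filter.eventually_atTop.1 (hlim.eventually_lt_const (abs_pos.2 hu0))
    have hdom : ∀ n, N ≤ n → |v * b ^ n| < |u| * a ^ n := fun n hn => by
      have h := hN n hn
      rw [div_pow, ← mul_div_assoc, div_lt_iff₀ (pow_pos ha n)] at h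
      rwa [abs_mul, abs_of_nonneg (pow_nonneg hb n)]
    refine ⟨N, ?_⟩
    rcases lt_or_gt_of_ne hu0 with h | h
    · refine Or.inl fun n hn => hneg n ?_
      have h1 := hdom n hn
      rw [abs_of_neg h] at h1
      have h2 := neg_abs_le (v * b ^ n)
      rw [hclosed]
      linarith
    · refine Or.inr (Or.inr fun n hn => pos_of_mul_pos_right (a := a - b) ?_ hpos.le)
      have h1 := hdom n hn
      rw [abs_of_pos h] at h1
      have h2 := le_abs_self (v * b ^ n)
      rw [hclosed]
      linarith

/-- The characteristic roots of the incidence matrix. -/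
theorem exists_char_roots {σ : Subst} (hmem : ∀ c d, d ∈ σ c) (heig : NonnegEigenvalues σ) :
    ∃ a b : ℝ, 0 ≤ b ∧ b < a ∧ ((incidence σ).trace : ℝ) = a + b ∧
      ((incidence σ).det : ℝ) = a * b := by
  have hpos : ∀ i j, 0 < (incidence σ i j : ℝ) := fun i j => by
    have := List.count_pos_iff.2 (hmem j i)
    simpa [incidence] using this
  set p : ℝ := ((incidence σ 0 0 : ℤ) : ℝ) with hp
  set q : ℝ := ((incidence σ 0 1 : ℤ) : ℝ) with hq
  set r : ℝ := ((incidence σ 1 0 : ℤ) : ℝ) with hr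
  set s : ℝ := ((incidence σ 1 1 : ℤ) : ℝ) with hs
  have hq0 : 0 < q := hpos 0 1
  have hr0 : 0 < r := hpos 1 0
  have hdisc : 0 < (p - s) ^ 2 + 4 * (q * r) := by positivity
  have hsq := Real.mul_self_sqrt hdisc.le
  have hsqpos := Real.sqrt_pos.2 hdisc
  set D := Real.sqrt ((p - s) ^ 2 + 4 * (q * r))
  have htr : ((incidence σ).trace : ℝ) = p + s := by
    rw [Matrix.trace_fin_two]; push_cast; rfl
  have hdet : ((incidence σ).det : ℝ) = p * s - q * r := by
    rw [Matrix.det_fin_two]; push_cast; rfl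
  refine ⟨(p + s + D) / 2, (p + s - D) / 2, ?_, by linarith, by rw [htr]; ring, ?_⟩
  · have hroot : q * r = ((p + s - D) / 2 - p) * ((p + s - D) / 2 - s) := by linarith
    set μ := (p + s - D) / 2
    have hev : Module.End.HasEigenvalue
        (Matrix.toLin' ((incidence σ).map (Int.cast : ℤ → ℂ))) (μ : ℂ) := by
      -- This vector solves the first row identically; the second row is the characteristic
      -- equation.
      refine Module.End.hasEigenvalue_of_hasEigenvector (x := ![(q : ℂ), ((μ - p : ℝ) : ℂ)]) ?_
      refine Module.End.hasEigenvector_iff.2 ⟨Module.End.mem_eigenspace_iff.2 ?_, ?_⟩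
      · have hroot' : (q : ℂ) * r = (μ - p) * (μ - s) := by exact_mod_cast hroot
        have e00 : ((incidence σ 0 0 : ℤ) : ℂ) = (p : ℂ) := by rw [hp]; norm_cast
        have e01 : ((incidence σ 0 1 : ℤ) : ℂ) = (q : ℂ) := by rw [hq]; norm_cast
        have e10 : ((incidence σ 1 0 : ℤ) : ℂ) = (r : ℂ) := by rw [hr]; norm_cast
        have e11 : ((incidence σ 1 1 : ℤ) : ℂ) = (s : ℂ) := by rw [hs]; norm_cast
        ext i
        fin_cases i
        · simp [Matrix.mulVec, dotProduct, Fin.sum_univ_two, e00, e01]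
          ring
        · simp [Matrix.mulVec, dotProduct, Fin.sum_univ_two, e10, e11]
          linear_combination hroot'
      · intro h
        have := congrFun h 0
        simp [hq0.ne'] at this
    exact (heig _ hev).1
  · rw [hdet]; linarith

/-- Synchronizing exponents exist for every pair of non-empty words. -/
theorem exists_synchronized {σ : Subst} (hmem : ∀ c d, d ∈ σ c) (heig : NonnegEigenvalues σ)
    {u v : Word} (hu : u ≠ []) (hv : v ≠ []) : ∃ m₁ m₂, Synchronized σ u v m₁ m₂ := by
  obtain ⟨a, b, hb, hab, htr, hdet⟩ := exists_char_roots hmem heig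
  have htri : ∀ k m : ℕ, ∃ N,
      (∀ n, N ≤ n → orbitLength σ u (k + n) < orbitLength σ v (m + n)) ∨
      (∀ n, N ≤ n → orbitLength σ u (k + n) = orbitLength σ v (m + n)) ∨
      ∀ n, N ≤ n → orbitLength σ v (m + n) < orbitLength σ u (k + n) := by
    intro k m
    obtain ⟨N, hN⟩ := eventually_sign_of_recurrence hb hab
      (d := fun n => (orbitLength σ u (k + n) : ℝ) - orbitLength σ v (m + n)) (fun n => by
        have h1 := orbitLength_add_two σ u (k + n)
        have h2 := orbitLength_add_two σ v (m + n)
        have h : ((orbitLength σ u (k + n + 2) : ℤ) : ℝ) - (orbitLength σ v (m + n + 2) : ℤ) =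
            (a + b) * ((orbitLength σ u (k + n + 1) : ℤ) - (orbitLength σ v (m + n + 1) : ℤ)) -
              a * b * ((orbitLength σ u (k + n) : ℤ) - (orbitLength σ v (m + n) : ℤ)) := by
          rw [h1, h2, ← htr, ← hdet]
          push_cast
          ring
        simpa only [Int.cast_natCast, add_assoc] using h)
    refine ⟨N, ?_⟩
    simpa only [sub_neg, sub_eq_zero, sub_pos, Nat.cast_lt, Nat.cast_inj] using hN
  obtain ⟨m, hm⟩ := exists_orbitLength_le hmem u hv
  obtain ⟨k', hk'⟩ := exists_orbitLength_le hmem ((opT σ)^[m] v) hu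
  have hex : ∃ k, ∃ N, ∀ n, N ≤ n → orbitLength σ v (m + n) < orbitLength σ u (k + n) := by
    refine ⟨k' + 1, 0, fun n _ => ?_⟩
    rw [← orbitLength_iterate]
    exact (hk' n).trans_lt (strictMono_orbitLength hmem hu (by omega))
  classical
  obtain ⟨k, hk⟩ : ∃ k, Nat.find hex = k + 1 := by
    -- The shift m was chosen so that v dominates the unshifted u; hence the least shift of u that
    -- eventually overtakes v is positive, and its predecessor k does not overtake.
    refine Nat.exists_eq_succ_of_ne_zero fun h0 => ?_
    obtain ⟨N, hN⟩ := Nat.find_spec hex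
    rw [h0] at hN
    have := hN N le_rfl
    have := hm N
    rw [zero_add] at *
    omega
  obtain ⟨N₁, hN₁⟩ := Nat.find_spec hex
  rw [hk] at hN₁
  have hmin := Nat.find_min hex (m := k) (by omega)
  obtain ⟨N₂, hN₂⟩ := htri k m
  refine ⟨k + (N₁ + N₂), m + (N₁ + N₂), ?_⟩
  change (∀ i, orbitLength σ u _ = orbitLength σ v _ ∧ orbitLength σ v _ < orbitLength σ u _) ∨
    ∀ i, orbitLength σ u _ < orbitLength σ v _ ∧ orbitLength σ v _ < orbitLength σ u _
  have hlast : ∀ i, orbitLength σ v (m + (N₁ + N₂) + i) <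
      orbitLength σ u (k + (N₁ + N₂) + i + 1) := fun i => by
    have := hN₁ (N₁ + N₂ + i) (by omega)
    rwa [show k + 1 + (N₁ + N₂ + i) = k + (N₁ + N₂) + i + 1 by omega, ← add_assoc m] at this
  rcases hN₂ with h | h | h
  · refine Or.inr fun i => ⟨?_, hlast i⟩
    simpa only [add_assoc] using h (N₁ + (N₂ + i)) (by omega)
  · refine Or.inl fun i => ⟨?_, hlast i⟩
    simpa only [add_assoc] using h (N₁ + (N₂ + i)) (by omega)
  · exact absurd ⟨N₂, h⟩ hmin

theorem exists_isSyncChoice {σ : Subst} (hmem : ∀ c d, d ∈ σ c) (heig : NonnegEigenvalues σ)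
    {E : Set Word} (hE : ∀ w ∈ E, w ≠ []) : ∃ m₁ m₂, IsSyncChoice σ E m₁ m₂ := by
  have h : ∀ u v : Word, ∃ m : ℕ × ℕ, u ∈ E → v ∈ E → Synchronized σ u v m.1 m.2 := by
    intro u v
    by_cases huv : u ∈ E ∧ v ∈ E
    · obtain ⟨m₁, m₂, hm⟩ := exists_synchronized hmem heig (hE u huv.1) (hE v huv.2)
      exact ⟨(m₁, m₂), fun _ _ => hm⟩
    · exact ⟨(0, 0), fun hu hv => absurd ⟨hu, hv⟩ huv⟩
  choose m hm using h
  exact ⟨fun u v => (m u v).1, fun u v => (m u v).2, fun u hu v hv => hm u v hu hv⟩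

theorem Synchronized.interlace {σ : Subst} {u v : Word} {m₁ m₂ : ℕ}
    (h : Synchronized σ u v m₁ m₂) (i : ℕ) :
    orbitLength σ u (m₁ + i) ≤ orbitLength σ v (m₂ + i) ∧
      orbitLength σ v (m₂ + i) < orbitLength σ u (m₁ + i + 1) := by
  rcases h with h | h
  · exact ⟨(h i).1.le, (h i).2⟩
  · exact ⟨(h i).1.le, (h i).2⟩

theorem Synchronized.self_eq {σ : Subst} {u : Word} {m₁ m₂ : ℕ}
    (h : Synchronized σ u u m₁ m₂) (hu : StrictMono (orbitLength σ u)) : m₁ = m₂ := by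
  have h0 := h.interlace 0
  have h1 := hu.le_iff_le.1 h0.1
  have h2 := hu.lt_iff_lt.1 h0.2
  omega

/-- Interlacing puts one iterate of v into each interval between consecutive iterates of u, always
with the offset m₂ - m₁. The strict bound m₁ < n makes the preceding interval available too. -/
theorem Synchronized.exponent_eq {σ : Subst} {u v : Word} {m₁ m₂ : ℕ}
    (h : Synchronized σ u v m₁ m₂) (hv : StrictMono (orbitLength σ v)) {n n' : ℕ} (hn : m₁ < n)
    (hle : orbitLength σ u n ≤ orbitLength σ v n')
    (hlt : orbitLength σ v n' < orbitLength σ u (n + 1)) : n' + m₁ = n + m₂ := by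
  obtain ⟨d, rfl⟩ := Nat.exists_eq_add_of_lt hn
  have h1 := hv.lt_iff_lt.1 ((h.interlace d).2.trans_le hle)
  have h2 := hv.lt_iff_lt.1 (hlt.trans_le (h.interlace (d + 2)).1)
  omega

theorem Synchronized.compare {σ : Subst} {u v : Word} {m₁ m₂ : ℕ}
    (h : Synchronized σ u v m₁ m₂) (hv : StrictMono (orbitLength σ v)) {n n' : ℕ} (hn : m₁ < n)
    (hle : orbitLength σ u n ≤ orbitLength σ v n')
    (hlt : orbitLength σ v n' < orbitLength σ u (n + 1)) :
    ((∀ j, orbitLength σ u (j + n) = orbitLength σ v (j + n')) ∨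
      ∀ j, orbitLength σ u (j + n) < orbitLength σ v (j + n')) ∧
      ∀ j, orbitLength σ v (j + n') < orbitLength σ u (j + 1 + n) := by
  have heq := h.exponent_eq hv hn hle hlt
  have e1 : ∀ j, j + n = m₁ + (j + (n - m₁)) := fun j => by omega
  have e2 : ∀ j, j + n' = m₂ + (j + (n - m₁)) := fun j => by omega
  have e3 : ∀ j, j + 1 + n = m₁ + (j + (n - m₁)) + 1 := fun j => by omega
  refine ⟨?_, fun j => by rw [e2, e3]; exact (h.interlace _).2⟩
  simp only [e1, e2]
  rcases h with h | h
  · exact Or.inl fun j => (h _).1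
  · exact Or.inr fun j => (h _).1

/-! ### Enumerations in unison -/

/-- A finite set can be enumerated with increasing keys, starting at a given element with
minimal key. -/
theorem exists_sorted_enumeration {α : Type*} [DecidableEq α] (F : Finset α) {x : α} (hx : x ∈ F)
    (key : α → ℕ) (hmin : ∀ y ∈ F, key x ≤ key y) :
    ∃ S : ℕ → α, Set.BijOn S (Set.Icc 1 F.card) F ∧ S 1 = x ∧
      ∀ k ∈ Set.Ico 1 F.card, key (S k) ≤ key (S (k + 1)) := by
  set l := (F.erase x).toList.mergeSort (fun a b => key a ≤ key b)
  have hl : ∀ y, y ∈ l ↔ y ≠ x ∧ y ∈ F := fun y => by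
    rw [List.mem_mergeSort, Finset.mem_toList, Finset.mem_erase]
  have hnodup : (x :: l).Nodup :=
    List.nodup_cons.2 ⟨fun h => ((hl x).1 h).1 rfl, List.nodup_mergeSort.2 (Finset.nodup_toList _)⟩
  have hmem : ∀ y, y ∈ x :: l ↔ y ∈ F := fun y => by
    rw [List.mem_cons, hl]
    by_cases hy : y = x
    · simp [hy, hx]
    · simp [hy]
  have hlen : (x :: l).length = F.card := by
    rw [List.length_cons, List.length_mergeSort, Finset.length_toList, Finset.card_erase_of_mem hx,
      Nat.sub_add_cancel (Finset.card_pos.2 ⟨x, hx⟩)]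
  have hsorted : (x :: l).Pairwise fun a b => key a ≤ key b := by
    refine List.pairwise_cons.2 ⟨fun y hy => hmin y ((hl y).1 hy).2, ?_⟩
    simpa using List.pairwise_mergeSort (le := fun a b => decide (key a ≤ key b))
      (fun a b c hab hbc => by simp at *; omega) (fun a b => by simp; omega) (F.erase x).toList
  have hget : ∀ k ∈ Set.Icc 1 F.card, ∃ h : k - 1 < (x :: l).length,
      (x :: l).getD (k - 1) x = (x :: l)[k - 1] := fun k hk => by
    have h : k - 1 < (x :: l).length := by have := hk.1; have := hk.2; omega
    exact ⟨h, List.getD_eq_getElem _ _ h⟩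
  refine ⟨fun k => (x :: l).getD (k - 1) x, ⟨fun k hk => ?_, fun i hi k hk hik => ?_,
    fun y hy => ?_⟩, rfl, fun k hk => ?_⟩
  · obtain ⟨h, h'⟩ := hget k hk
    exact (hmem _).1 (h'.symm ▸ List.getElem_mem h : (x :: l).getD (k - 1) x ∈ x :: l)
  · obtain ⟨h, h'⟩ := hget k hk
    obtain ⟨g, g'⟩ := hget i hi
    simp only [h', g'] at hik
    have := hnodup.getElem_inj_iff.1 hik
    have := hi.1
    have := hk.1
    omega
  · obtain ⟨t, ht, hty⟩ := List.mem_iff_getElem.1 ((hmem y).2 hy)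
    refine ⟨t + 1, ⟨by omega, by omega⟩, ?_⟩
    simp only [Nat.add_sub_cancel]
    rw [List.getD_eq_getElem _ _ ht, hty]
  · obtain ⟨h, h'⟩ := hget k ⟨hk.1, hk.2.le⟩
    obtain ⟨g, g'⟩ := hget (k + 1) ⟨by omega, hk.2⟩
    simp only [h', g']
    exact List.pairwise_iff_getElem.1 hsorted _ _ h g (by have := hk.1; omega)

/-- The exponent of v is forced by synchronization with w: it is n shifted by the offset of the
pair. `hlarge` says that these exponents exceed all the synchronizing ones. -/
theorem exists_isUnison {σ : Subst} {E : Set Word} (hfin : E.Finite)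
    (hmono : ∀ w ∈ E, StrictMono (orbitLength σ w)) {m₁ m₂ : Word → Word → ℕ}
    (hsync : IsSyncChoice σ E m₁ m₂) {w : Word} (hw : w ∈ E) {n : ℕ}
    (hn : ∀ v ∈ E, m₁ w v < n)
    (hlarge : ∀ v ∈ E, ∀ W₁ ∈ E, ∀ W₂ ∈ E,
      m₁ W₁ W₂ + m₁ w v < n + m₂ w v ∧ m₂ W₁ W₂ + m₁ w v < n + m₂ w v) :
    ∃ K S e, IsUnison σ E m₁ m₂ K S e ∧ S 1 = w ∧ e 1 = n := by
  classical
  set ε : Word → ℕ := fun v => n + m₂ w v - m₁ w v with hε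
  have hεw : ε w = n := by
    have := (hsync w hw w hw).self_eq (hmono w hw)
    simp only [hε]
    omega
  have hint : ∀ v ∈ E, orbitLength σ w n ≤ orbitLength σ v (ε v) ∧
      orbitLength σ v (ε v) < orbitLength σ w (n + 1) := fun v hv => by
    have h := (hsync w hw v hv).interlace (n - m₁ w v)
    have hlt := hn v hv
    rwa [show m₂ w v + (n - m₁ w v) = ε v by simp only [hε]; omega,
      show m₁ w v + (n - m₁ w v) = n by omega] at h
  have hF : ∀ v, v ∈ hfin.toFinset ↔ v ∈ E := fun v => hfin.mem_toFinset
  obtain ⟨S, hS, hS1, hsort⟩ := exists_sorted_enumeration hfin.toFinset ((hF w).2 hw)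
    (fun v => orbitLength σ v (ε v))
    (fun v hv => by rw [hεw]; exact (hint v ((hF v).1 hv)).1)
  rw [hfin.coe_toFinset] at hS
  have hK : 1 ≤ hfin.toFinset.card := Finset.card_pos.2 ⟨w, (hF w).2 hw⟩
  refine ⟨hfin.toFinset.card, S, fun k => ε (S k), ⟨hK, hS, ?_, ?_, ?_⟩, hS1, by
    simp only [hS1, hεw]⟩
  · intro k hk W₁ h₁ W₂ h₂
    have := hlarge (S k) (hS.mapsTo hk) W₁ h₁ W₂ h₂
    simp only [hε]
    omega
  · intro k hk
    simpa [pointN, orbitLength] using hsort k hk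
  · have := (hint (S hfin.toFinset.card) (hS.mapsTo ⟨hK, le_rfl⟩)).2
    rw [← hεw, ← hS1, add_comm] at this
    simpa only [pointN, orbitLength, zero_add] using this

/-- Every word of `E` starts an enumeration in unison, with any large exponent. -/
theorem exists_isUnison_of_large {σ : Subst} {E : Set Word} (hfin : E.Finite)
    (hmono : ∀ w ∈ E, StrictMono (orbitLength σ w)) {m₁ m₂ : Word → Word → ℕ}
    (hsync : IsSyncChoice σ E m₁ m₂) {w : Word} (hw : w ∈ E) :
    ∃ n₀, ∀ n, n₀ ≤ n → ∃ K S e, IsUnison σ E m₁ m₂ K S e ∧ S 1 = w ∧ e 1 = n := by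
  obtain ⟨B, hB⟩ : ∃ B, ∀ u ∈ E, ∀ v ∈ E, m₁ u v ≤ B ∧ m₂ u v ≤ B := by
    obtain ⟨B, hB⟩ := ((hfin.prod hfin).image fun p => max (m₁ p.1 p.2) (m₂ p.1 p.2)).bddAbove
    refine ⟨B, fun u hu v hv => ?_⟩
    have := hB ⟨(u, v), ⟨hu, hv⟩, rfl⟩
    exact ⟨(le_max_left _ _).trans this, (le_max_right _ _).trans this⟩
  -- An offset lowers the exponent by at most B, and the result must still exceed B.
  refine ⟨2 * B + 1, fun n hn => exists_isUnison hfin hmono hsync hw ?_ ?_⟩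
  · intro v hv
    have := hB w hw v hv
    omega
  · intro v hv W₁ h₁ W₂ h₂
    have := hB w hw v hv
    have := hB W₁ h₁ W₂ h₂
    omega

/-- A word of `E` with the longest iterates starts an enumeration in unison with every exponent
beyond the synchronizing ones. -/
theorem exists_isUnison_of_nonempty {σ : Subst} {E : Set Word} (hfin : E.Finite)
    (hmono : ∀ w ∈ E, StrictMono (orbitLength σ w)) {m₁ m₂ : Word → Word → ℕ}
    (hsync : IsSyncChoice σ E m₁ m₂) (hne : E.Nonempty) :
    ∃ w ∈ E, ∀ n, (∀ W₁ ∈ E, ∀ W₂ ∈ E, m₁ W₁ W₂ < n ∧ m₂ W₁ W₂ < n) →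
      ∃ K S e, IsUnison σ E m₁ m₂ K S e ∧ S 1 = w ∧ e 1 = n := by
  obtain ⟨B, hB⟩ : ∃ B, ∀ u ∈ E, ∀ v ∈ E, m₁ u v ≤ B := by
    obtain ⟨B, hB⟩ := ((hfin.prod hfin).image fun p => m₁ p.1 p.2).bddAbove
    exact ⟨B, fun u hu v hv => hB ⟨(u, v), ⟨hu, hv⟩, rfl⟩⟩
  -- When w has the longest iterate at a common exponent beyond all m₁, its offset to any other word
  -- is non-negative, so no exponent falls below n.
  obtain ⟨w, hw, hmax⟩ := Set.exists_max_image E (fun v => orbitLength σ v B) hfin hne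
  refine ⟨w, hw, fun n hn => exists_isUnison hfin hmono hsync hw (fun v hv => (hn w hw v hv).1) ?_⟩
  intro v hv W₁ h₁ W₂ h₂
  have hle : m₁ w v ≤ m₂ w v := by
    have hBv := hB w hw v hv
    have h := ((hsync w hw v hv).interlace (B - m₁ w v)).1
    rw [show m₁ w v + (B - m₁ w v) = B by omega] at h
    have := (hmono v hv).le_iff_le.1 ((hmax v hv).trans h)
    omega
  have := hn W₁ h₁ W₂ h₂
  omega

/-! ### Points and blocks of a fixed enumeration -/

namespace IsUnison

variable {σ : Subst} {E : Set Word} {m₁ m₂ : Word → Word → ℕ} {K : ℕ} {S : ℕ → Word} {e : ℕ → ℕ}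

theorem one_mem (h : IsUnison σ E m₁ m₂ K S e) : 1 ∈ Set.Icc 1 K := ⟨le_rfl, h.pos⟩

theorem pointN_zero_mono (h : IsUnison σ E m₁ m₂ K S e) {i k : ℕ} (hi : 1 ≤ i) (hik : i ≤ k)
    (hk : k ≤ K) : pointN σ S e i 0 ≤ pointN σ S e k 0 := by
  induction k, hik using Nat.le_induction with
  | base => exact le_rfl
  | succ k hik ih => exact (ih (by omega)).trans (h.sorted k ⟨by omega, by omega⟩)

theorem pointN_zero_lt (h : IsUnison σ E m₁ m₂ K S e) {k : ℕ} (hk : k ∈ Set.Icc 1 K) :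
    pointN σ S e k 0 < pointN σ S e 1 1 :=
  (h.pointN_zero_mono hk.1 hk.2 le_rfl).trans_lt h.last

theorem compare_aux (h : IsUnison σ E m₁ m₂ K S e) (hsync : IsSyncChoice σ E m₁ m₂)
    (hmono : ∀ w ∈ E, StrictMono (orbitLength σ w)) {i k : ℕ} (hi : i ∈ Set.Icc 1 K)
    (hk : k ∈ Set.Icc 1 K) (hle : pointN σ S e k 0 ≤ pointN σ S e i 0)
    (hlt : pointN σ S e i 0 < pointN σ S e k 1) :
    ((∀ j, pointN σ S e k j = pointN σ S e i j) ∨ ∀ j, pointN σ S e k j < pointN σ S e i j) ∧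
      ∀ j, pointN σ S e i j < pointN σ S e k (j + 1) := by
  have hSi := h.enum.mapsTo hi
  have hSk := h.enum.mapsTo hk
  refine (hsync _ hSk _ hSi).compare (hmono _ hSi) (h.large k hk _ hSk _ hSi).1 ?_ ?_
  · simpa only [pointN, orbitLength, zero_add] using hle
  · simpa only [pointN, orbitLength, zero_add, add_comm 1] using hlt

/-- The points keep their order, and coinciding points keep coinciding. -/
theorem compare (h : IsUnison σ E m₁ m₂ K S e) (hsync : IsSyncChoice σ E m₁ m₂)
    (hmono : ∀ w ∈ E, StrictMono (orbitLength σ w)) {i k : ℕ} (hi : i ∈ Set.Icc 1 K)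
    (hk : k ∈ Set.Icc 1 K) (hle : pointN σ S e k 0 ≤ pointN σ S e i 0) :
    ((∀ j, pointN σ S e k j = pointN σ S e i j) ∨ ∀ j, pointN σ S e k j < pointN σ S e i j) ∧
      ∀ j, pointN σ S e i j < pointN σ S e k (j + 1) := by
  refine h.compare_aux hsync hmono hi hk hle ((h.pointN_zero_lt hi).trans_le ?_)
  -- The missing upper bound comes from comparing S_k with S_1: N_1^1 ≤ N_k^1.
  rcases (h.compare_aux hsync hmono hk h.one_mem (h.pointN_zero_mono le_rfl hk.1 hk.2)
    (h.pointN_zero_lt hk)).1 with h' | h'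
  · exact (h' 1).le
  · exact (h' 1).le

theorem pointN_le_iff (h : IsUnison σ E m₁ m₂ K S e) (hsync : IsSyncChoice σ E m₁ m₂)
    (hmono : ∀ w ∈ E, StrictMono (orbitLength σ w)) {i k : ℕ} (hi : i ∈ Set.Icc 1 K)
    (hk : k ∈ Set.Icc 1 K) (j : ℕ) :
    pointN σ S e k j ≤ pointN σ S e i j ↔ pointN σ S e k 0 ≤ pointN σ S e i 0 := by
  rcases le_or_gt (pointN σ S e k 0) (pointN σ S e i 0) with hle | hlt
  · refine ⟨fun _ => hle, fun _ => ?_⟩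
    rcases (h.compare hsync hmono hi hk hle).1 with h' | h'
    · exact (h' j).le
    · exact (h' j).le
  · rcases (h.compare hsync hmono hk hi hlt.le).1 with h' | h'
    · exact absurd (h' 0) hlt.ne
    · have := h' j
      omega

theorem pointN_eq_iff (h : IsUnison σ E m₁ m₂ K S e) (hsync : IsSyncChoice σ E m₁ m₂)
    (hmono : ∀ w ∈ E, StrictMono (orbitLength σ w)) {i k : ℕ} (hi : i ∈ Set.Icc 1 K)
    (hk : k ∈ Set.Icc 1 K) (j : ℕ) :
    pointN σ S e k j = pointN σ S e i j ↔ pointN σ S e k 0 = pointN σ S e i 0 := by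
  simp only [le_antisymm_iff, h.pointN_le_iff hsync hmono hi hk j,
    h.pointN_le_iff hsync hmono hk hi j]

theorem pointN_mono (h : IsUnison σ E m₁ m₂ K S e) (hsync : IsSyncChoice σ E m₁ m₂)
    (hmono : ∀ w ∈ E, StrictMono (orbitLength σ w)) {i k : ℕ} (hi : 1 ≤ i) (hik : i ≤ k)
    (hk : k ≤ K) (j : ℕ) : pointN σ S e i j ≤ pointN σ S e k j :=
  (h.pointN_le_iff hsync hmono ⟨by omega, hk⟩ ⟨hi, by omega⟩ j).2 (h.pointN_zero_mono hi hik hk)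

theorem pointN_mem_block (h : IsUnison σ E m₁ m₂ K S e) (hsync : IsSyncChoice σ E m₁ m₂)
    (hmono : ∀ w ∈ E, StrictMono (orbitLength σ w)) {k : ℕ} (hk : k ∈ Set.Icc 1 K) (j : ℕ) :
    pointN σ S e k j ∈ block (pointN σ S e) j :=
  ⟨h.pointN_mono hsync hmono le_rfl hk.1 hk.2 j,
    (h.compare hsync hmono hk h.one_mem (h.pointN_zero_mono le_rfl hk.1 hk.2)).2 j⟩

/-- The only iterate of `T` on `S_k` whose length lies in `I^j` is the one of length `N_k^j`. -/
theorem exponent_eq (h : IsUnison σ E m₁ m₂ K S e) (hsync : IsSyncChoice σ E m₁ m₂)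
    (hmono : ∀ w ∈ E, StrictMono (orbitLength σ w)) {k : ℕ} (hk : k ∈ Set.Icc 1 K) {j n : ℕ}
    (hn : orbitLength σ (S k) n ∈ block (pointN σ S e) j) : n = j + e k := by
  have hSk := h.enum.mapsTo hk
  have hS1 := h.enum.mapsTo h.one_mem
  have hlt := (h.large 1 h.one_mem _ hS1 _ hSk).1
  have key : ∀ n, orbitLength σ (S k) n ∈ block (pointN σ S e) j →
      n + m₁ (S 1) (S k) = j + e 1 + m₂ (S 1) (S k) := fun n hn =>
    (hsync _ hS1 _ hSk).exponent_eq (hmono _ hSk) (by omega) hn.1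
      (by rw [add_right_comm]; exact hn.2)
  have h1 := key n hn
  have h2 := key (j + e k) (h.pointN_mem_block hsync hmono hk j)
  omega

theorem strictMono_pointN (h : IsUnison σ E m₁ m₂ K S e)
    (hmono : ∀ w ∈ E, StrictMono (orbitLength σ w)) {k : ℕ} (hk : k ∈ Set.Icc 1 K) :
    StrictMono (pointN σ S e k) := fun i j hij =>
  hmono _ (h.enum.mapsTo hk) (by omega : i + e k < j + e k)

/-- The intervals `I^j` partition `[N_1^0, ∞)`. -/
theorem existsUnique_block (h : IsUnison σ E m₁ m₂ K S e)
    (hmono : ∀ w ∈ E, StrictMono (orbitLength σ w)) {n : ℕ} (hn : pointN σ S e 1 0 ≤ n) :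
    ∃! j, n ∈ block (pointN σ S e) j := by
  have hm := h.strictMono_pointN hmono h.one_mem
  have hex : ∃ j, n < pointN σ S e 1 (j + 1) := ⟨n, Nat.lt_of_succ_le hm.le_apply⟩
  classical
  refine ⟨Nat.find hex, ⟨?_, Nat.find_spec hex⟩, fun j hj => ?_⟩
  · rcases hj : Nat.find hex with _ | j
    · exact hn
    · exact not_lt.1 (Nat.find_min hex (m := j) (by omega))
  · refine le_antisymm ?_ (Nat.find_le hj.2)
    by_contra hlt
    have := hm.monotone (show Nat.find hex + 1 ≤ j by omega)
    have := Nat.find_spec hex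
    have := hj.1
    omega

theorem lt_of_mem_subblock (h : IsUnison σ E m₁ m₂ K S e) (hsync : IsSyncChoice σ E m₁ m₂)
    (hmono : ∀ w ∈ E, StrictMono (orbitLength σ w)) {i k : ℕ} (hik : k < i)
    (hi : i ≤ K) {j n : ℕ} (hn : n ∈ subblock K (pointN σ S e) k j) :
    n < pointN σ S e i j := by
  have hn2 := hn.2
  rw [if_pos (by omega)] at hn2
  exact hn2.trans_le (h.pointN_mono hsync hmono (by omega) hik hi j)

/-- The intervals `I_k^j` partition `I^j`. -/
theorem existsUnique_subblock (h : IsUnison σ E m₁ m₂ K S e) (hsync : IsSyncChoice σ E m₁ m₂)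
    (hmono : ∀ w ∈ E, StrictMono (orbitLength σ w)) {j n : ℕ}
    (hn : n ∈ block (pointN σ S e) j) :
    ∃! k, k ∈ Set.Icc 1 K ∧ n ∈ subblock K (pointN σ S e) k j := by
  classical
  set k := Nat.findGreatest (fun k => pointN σ S e k j ≤ n) K
  have hk1 : 1 ≤ k := Nat.le_findGreatest h.pos hn.1
  have hkK : k ≤ K := Nat.findGreatest_le K
  have hk : k ∈ Set.Icc 1 K ∧ n ∈ subblock K (pointN σ S e) k j := by
    refine ⟨⟨hk1, hkK⟩, Nat.findGreatest_spec (P := fun k => pointN σ S e k j ≤ n) h.pos hn.1, ?_⟩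
    split_ifs with hlt
    · exact not_le.1 (Nat.findGreatest_is_greatest (P := fun k => pointN σ S e k j ≤ n)
        (Nat.lt_succ_self k) hlt)
    · exact hn.2
  refine ⟨k, hk, fun i hi => ?_⟩
  rcases lt_trichotomy i k with hlt | heq | hlt
  · exact absurd hk.2.1 (not_le.2 (h.lt_of_mem_subblock hsync hmono hlt hkK hi.2))
  · exact heq
  · exact absurd hi.2.1 (not_le.2 (h.lt_of_mem_subblock hsync hmono hlt hi.1.2 hk.2))

theorem stepSum_eq (h : IsUnison σ E m₁ m₂ K S e) (hsync : IsSyncChoice σ E m₁ m₂)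
    (hmono : ∀ w ∈ E, StrictMono (orbitLength σ w)) {j n k : ℕ}
    (hn : n ∈ block (pointN σ S e) j) (hk : k ∈ Set.Icc 1 K)
    (hnk : n ∈ subblock K (pointN σ S e) k j) (d : ℕ → ℤ) :
    stepSum K (pointN σ S e) d j n = d k := by
  rw [stepSum, Finset.sum_eq_single k]
  · rw [Set.indicator_of_mem hnk, mul_one]
  · intro i hi hik
    rw [Set.indicator_of_notMem, mul_zero]
    intro hni
    exact hik ((h.existsUnique_subblock hsync hmono hn).unique
      ⟨Finset.mem_Icc.1 hi, hni⟩ ⟨hk, hnk⟩)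
  · intro hk'
    exact absurd (Finset.mem_Icc.2 hk) hk'

/-- The total jump is the sum of the signs over all the points up to `N_k^0`. -/
theorem totalJump_eq (h : IsUnison σ E m₁ m₂ K S e) (ξ : ℕ → Fin 2) (C : ℕ) {k : ℕ}
    (hk : k ∈ Set.Icc 1 K) :
    totalJump σ ξ C K S e k = ∑ i ∈ Finset.Icc 1 K,
      if pointN σ S e i 0 ≤ pointN σ S e k 0 then sgn σ ξ C (S i) else 0 := by
  simp only [totalJump, jump]
  -- After the interchange, each i with N_i^0 ≤ N_k^0 is counted once, by the first index a whose
  -- point equals N_i^0.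
  rw [Finset.sum_comm]
  refine Finset.sum_congr rfl fun i hi => ?_
  rw [Finset.mem_Icc] at hi
  split_ifs with hle
  · have hex : ∃ a, 1 ≤ a ∧ pointN σ S e a 0 = pointN σ S e i 0 := ⟨i, hi.1, rfl⟩
    classical
    obtain ⟨ha1, ha⟩ := Nat.find_spec hex
    have hmin : ∀ b, b < Nat.find hex → 1 ≤ b → pointN σ S e b 0 ≠ pointN σ S e i 0 :=
      fun b hb hb1 hbi => Nat.find_min hex hb ⟨hb1, hbi⟩
    have hak : Nat.find hex ≤ k := by
      rcases le_total i k with hik | hki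
      · exact (Nat.find_le ⟨hi.1, rfl⟩).trans hik
      · exact Nat.find_le ⟨hk.1, le_antisymm (h.pointN_zero_mono hk.1 hki hi.2) hle⟩
    generalize Nat.find hex = a at ha1 ha hmin hak
    rw [Finset.sum_eq_single a]
    · rw [if_pos ha.symm]
    · intro b hb hba
      rw [Finset.mem_filter, Finset.mem_Icc] at hb
      refine if_neg fun hib => ?_
      rcases lt_or_gt_of_ne hba with hlt | hlt
      · exact hmin b hlt hb.1.1 hib.symm
      · exact hb.2 a hlt ha1 (ha.trans hib)
    · intro hna
      refine absurd (Finset.mem_filter.2 ⟨Finset.mem_Icc.2 ⟨ha1, hak⟩, fun b hb hb1 => ?_⟩) hna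
      rw [ha]
      exact hmin b hb hb1
  · refine Finset.sum_eq_zero fun a ha => if_neg fun hia => hle ?_
    rw [Finset.mem_filter, Finset.mem_Icc] at ha
    exact hia.le.trans (h.pointN_zero_mono ha.1.1 ha.1.2 hk.2)

/-! ### Increments and values of s on the blocks -/

section Increments

variable {ξ : ℕ → Fin 2} {C : ℕ}

theorem bigL_lt (h : IsUnison σ (initSpecial σ ξ C) m₁ m₂ K S e)
    (hmono : ∀ w ∈ initSpecial σ ξ C, StrictMono (orbitLength σ w)) {n : ℕ}
    (hn : pointN σ S e 1 0 ≤ n) : bigL σ C < n := by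
  have hS1 := h.enum.mapsTo h.one_mem
  have he := (h.large 1 h.one_mem _ hS1 _ hS1).1
  calc bigL σ C < orbitLength σ (S 1) 1 := bigL_lt_of_mem_initSpecial hS1
    _ ≤ orbitLength σ (S 1) (0 + e 1) := (hmono _ hS1).monotone (by omega)
    _ ≤ n := hn

/-- The increments of `s` on `I^j`. -/
theorem specialCount_succ_sub (h : IsUnison σ (initSpecial σ ξ C) m₁ m₂ K S e)
    (hsync : IsSyncChoice σ (initSpecial σ ξ C) m₁ m₂) (hσ : WellMarked σ)
    (hmem : ∀ c d, d ∈ σ c) (hξ : IsFixedPoint σ ξ) (hC : IsRecogConst σ ξ C)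
    {j n : ℕ} (hn : n ∈ block (pointN σ S e) j) :
    (specialCount ξ (n + 1) : ℤ) - specialCount ξ n =
      ∑ i ∈ Finset.Icc 1 K, if pointN σ S e i j = n then sgn σ ξ C (S i) else 0 := by
  have hmono : ∀ w ∈ initSpecial σ ξ C, StrictMono (orbitLength σ w) := fun w hw =>
    strictMono_orbitLength hmem (ne_nil_of_mem_initSpecial hw)
  have hle : pointN σ S e 1 0 ≤ n :=
    ((h.strictMono_pointN hmono h.one_mem).monotone (Nat.zero_le j)).trans hn.1
  classical
  rw [specialCount_succ_sub_eq_sum hσ hmem hξ hC h.enum (h.bigL_lt hmono hle)]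
  refine Finset.sum_congr rfl fun i hi => ?_
  congr 1
  refine propext ⟨?_, fun hi => ⟨_, hi⟩⟩
  rintro ⟨m, rfl⟩
  rw [h.exponent_eq hsync hmono (Finset.mem_Icc.1 hi) hn]
  rfl

/-- The values of `s` on `I^j`. -/
theorem specialCount_succ_eq (h : IsUnison σ (initSpecial σ ξ C) m₁ m₂ K S e)
    (hsync : IsSyncChoice σ (initSpecial σ ξ C) m₁ m₂) (hσ : WellMarked σ)
    (hmem : ∀ c d, d ∈ σ c) (hξ : IsFixedPoint σ ξ) (hC : IsRecogConst σ ξ C)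
    {j n : ℕ} (hn : n ∈ block (pointN σ S e) j) :
    (specialCount ξ (n + 1) : ℤ) = specialCount ξ (pointN σ S e 1 j) +
      stepSum K (pointN σ S e) (totalJump σ ξ C K S e) j n := by
  have hmono : ∀ w ∈ initSpecial σ ξ C, StrictMono (orbitLength σ w) := fun w hw =>
    strictMono_orbitLength hmem (ne_nil_of_mem_initSpecial hw)
  have hsum : (specialCount ξ (n + 1) : ℤ) = specialCount ξ (pointN σ S e 1 j) +
      ∑ i ∈ Finset.Icc 1 K, if pointN σ S e i j ≤ n then sgn σ ξ C (S i) else 0 := by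
    obtain ⟨hn1, hn2⟩ := hn
    induction n, hn1 using Nat.le_induction with
    | base =>
      have := h.specialCount_succ_sub hsync hσ hmem hξ hC ⟨le_rfl, hn2⟩
      rw [← sub_eq_iff_eq_add', this]
      refine Finset.sum_congr rfl fun i hi => ?_
      rw [Finset.mem_Icc] at hi
      congr 1
      exact propext ⟨le_of_eq,
        fun hle => le_antisymm hle (h.pointN_mono hsync hmono le_rfl hi.1 hi.2 j)⟩
    | succ n hn1 ih =>
      have hinc := h.specialCount_succ_sub hsync hσ hmem hξ hC (n := n + 1) ⟨by omega, hn2⟩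
      rw [sub_eq_iff_eq_add.1 hinc, ih (by omega), add_comm, add_assoc,
        ← Finset.sum_add_distrib]
      congr 1
      refine Finset.sum_congr rfl fun i _ => ?_
      rcases lt_trichotomy (pointN σ S e i j) (n + 1) with hlt | heq | hlt
      · rw [if_pos (by omega), if_neg (by omega), if_pos (by omega), add_zero]
      · rw [if_neg (by omega), if_pos heq, if_pos heq.le, zero_add]
      · rw [if_neg (by omega), if_neg (by omega), if_neg (by omega), add_zero]
  obtain ⟨k, ⟨hk, hnk⟩, -⟩ := h.existsUnique_subblock hsync hmono hn
  rw [hsum, h.stepSum_eq hsync hmono hn hk hnk, h.totalJump_eq ξ C hk]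
  congr 1
  refine Finset.sum_congr rfl fun i hi => ?_
  rw [Finset.mem_Icc] at hi
  congr 1
  -- The order of the points does not depend on j, so the condition on block 0 can be read on block
  -- j.
  rw [← h.pointN_le_iff hsync hmono hk hi j]
  refine propext ⟨fun hle => ?_, fun hle => hle.trans hnk.1⟩
  rcases le_or_gt i k with hik | hki
  · exact h.pointN_mono hsync hmono hi.1 hik hk.2 j
  · exact absurd hle (not_le.2 (h.lt_of_mem_subblock hsync hmono hki hi.2 hnk))

/-- The jump of `s` at `N_k^j` is `c_k`. -/
theorem specialCount_jump (h : IsUnison σ (initSpecial σ ξ C) m₁ m₂ K S e)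
    (hsync : IsSyncChoice σ (initSpecial σ ξ C) m₁ m₂) (hσ : WellMarked σ)
    (hmem : ∀ c d, d ∈ σ c) (hξ : IsFixedPoint σ ξ) (hC : IsRecogConst σ ξ C)
    (j : ℕ) {k : ℕ} (hk : k ∈ Set.Icc 1 K) :
    (specialCount ξ (pointN σ S e k j + 1) : ℤ) - specialCount ξ (pointN σ S e k j) =
      jump σ ξ C K S e k := by
  have hmono : ∀ w ∈ initSpecial σ ξ C, StrictMono (orbitLength σ w) := fun w hw =>
    strictMono_orbitLength hmem (ne_nil_of_mem_initSpecial hw)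
  rw [h.specialCount_succ_sub hsync hσ hmem hξ hC (h.pointN_mem_block hsync hmono hk j), jump]
  refine Finset.sum_congr rfl fun i hi => ?_
  congr 1
  exact propext (h.pointN_eq_iff hsync hmono hk (Finset.mem_Icc.1 hi) j)

/-- `s` does not jump away from the points `N_k^j`. -/
theorem specialCount_no_jump (h : IsUnison σ (initSpecial σ ξ C) m₁ m₂ K S e)
    (hsync : IsSyncChoice σ (initSpecial σ ξ C) m₁ m₂) (hσ : WellMarked σ)
    (hmem : ∀ c d, d ∈ σ c) (hξ : IsFixedPoint σ ξ) (hC : IsRecogConst σ ξ C)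
    {n : ℕ} (hn : pointN σ S e 1 0 ≤ n)
    (hne : ∀ j, ∀ k ∈ Set.Icc 1 K, n ≠ pointN σ S e k j) :
    specialCount ξ (n + 1) = specialCount ξ n := by
  have hmono : ∀ w ∈ initSpecial σ ξ C, StrictMono (orbitLength σ w) := fun w hw =>
    strictMono_orbitLength hmem (ne_nil_of_mem_initSpecial hw)
  obtain ⟨j, hj, -⟩ := h.existsUnique_block hmono hn
  have hinc := h.specialCount_succ_sub hsync hσ hmem hξ hC hj
  rw [Finset.sum_eq_zero fun i hi => if_neg (hne j i (Finset.mem_Icc.1 hi)).symm] at hinc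
  omega

/-- The recurrences and the initial values determine the complexity. -/
theorem complexity_determined (h : IsUnison σ (initSpecial σ ξ C) m₁ m₂ K S e)
    (hsync : IsSyncChoice σ (initSpecial σ ξ C) m₁ m₂) (hσ : WellMarked σ)
    (hmem : ∀ c d, d ∈ σ c) (hξ : IsFixedPoint σ ξ) (hC : IsRecogConst σ ξ C)
    {N : ℕ → ℕ → ℕ} {P : ℕ → ℤ}
    (hN : ∀ k ∈ Set.Icc 1 K, N k 0 = pointN σ S e k 0 ∧ N k 1 = pointN σ S e k 1 ∧
      LengthRecurrence σ (N k))
    (hinit : ∀ n, n ≤ pointN σ S e 1 0 + 1 → P n = complexity ξ n)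
    (hP : ∀ j, ∀ n ∈ block N j, P (n + 2) - P (n + 1) = P (N 1 j + 1) - P (N 1 j) +
      stepSum K N (totalJump σ ξ C K S e) j n) (n : ℕ) : P n = complexity ξ n := by
  have hmono : ∀ w ∈ initSpecial σ ξ C, StrictMono (orbitLength σ w) := fun w hw =>
    strictMono_orbitLength hmem (ne_nil_of_mem_initSpecial hw)
  have hNp : ∀ k ∈ Set.Icc 1 K, ∀ j, N k j = pointN σ S e k j := by
    intro k hk j
    obtain ⟨h0, h1, hrec⟩ := hN k hk
    induction j using Nat.twoStepInduction with
    | zero => exact h0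
    | one => exact h1
    | more j ih0 ih1 =>
      have := hrec j
      rw [ih0, ih1, ← lengthRecurrence_pointN σ S e k j] at this
      exact_mod_cast this
  have hstep : ∀ j n, stepSum K N (totalJump σ ξ C K S e) j n =
      stepSum K (pointN σ S e) (totalJump σ ξ C K S e) j n := by
    intro j n
    refine Finset.sum_congr rfl fun k hk => ?_
    rw [Finset.mem_Icc] at hk
    have : subblock K N k j = subblock K (pointN σ S e) k j := by
      rw [subblock, subblock, hNp k hk, hNp 1 h.one_mem]
      split_ifs with hlt
      · rw [hNp (k + 1) ⟨by omega, hlt⟩]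
      · rfl
    rw [this]
  induction n using Nat.strong_induction_on with
  | _ n ih =>
  by_cases hn : n ≤ pointN σ S e 1 0 + 1
  · exact hinit n hn
  obtain ⟨n, rfl⟩ : ∃ n', n = n' + 2 := ⟨n - 2, by omega⟩
  obtain ⟨j, hj, -⟩ := h.existsUnique_block hmono (show pointN σ S e 1 0 ≤ n by omega)
  have h1 := hP j n (by rw [block, hNp 1 h.one_mem, hNp 1 h.one_mem]; exact hj)
  have hj1 := hj.1
  -- All arguments of P other than n + 2 are smaller, and P(N_1^j + 1) - P(N_1^j) becomes s(N_1^j).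
  rw [hstep, hNp 1 h.one_mem, ih (n + 1) (by omega),
    ih (pointN σ S e 1 j + 1) (by omega), ih (pointN σ S e 1 j) (by omega)] at h1
  have h2 := h.specialCount_succ_eq hsync hσ hmem hξ hC hj
  have h3 := complexity_succ ξ (n + 1)
  have h4 := complexity_succ ξ (pointN σ S e 1 j)
  rw [add_assoc] at h3
  push_cast [h4] at h1
  rw [show n + (1 + 1) = n + 2 from rfl] at h3
  push_cast [h3]
  linarith

end Increments

end IsUnison

end BinSubst

theorem mainTheorem1 (σ : Subst) (hσ : WellMarked σ) (hprim : (incidence σ).IsPrimitive)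
    (heig : NonnegEigenvalues σ) (ξ : ℕ → Fin 2) (hξ : IsFixedPoint σ ξ)
    (hper : ¬ UltimatelyPeriodic ξ) :
    -- the special words count the increments of the complexity
    (∀ n : ℕ, (specialCount ξ n : ℤ) = complexity ξ (n + 1) - complexity ξ n) ∧
    -- recognizability constants exist, and the result holds for each of them
    (∃ C : ℕ, IsRecogConst σ ξ C) ∧
    ∀ C : ℕ, IsRecogConst σ ξ C →
      -- no initial special words: `s` is constant beyond `L`
      (initSpecial σ ξ C = ∅ → ∀ n : ℕ, bigL σ C < n → specialCount ξ (n + 1) = specialCount ξ n) ∧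
      -- synchronizing exponents exist
      (∃ m₁ m₂ : Word → Word → ℕ, IsSyncChoice σ (initSpecial σ ξ C) m₁ m₂) ∧
      ∀ m₁ m₂ : Word → Word → ℕ, IsSyncChoice σ (initSpecial σ ξ C) m₁ m₂ →
        -- any initial special word can be `S_1`, with any large exponent `n_1`
        (∀ W ∈ initSpecial σ ξ C, ∃ n₀ : ℕ, ∀ n₁ : ℕ, n₀ ≤ n₁ →
          ∃ (K : ℕ) (S : ℕ → Word) (e : ℕ → ℕ),
            IsUnison σ (initSpecial σ ξ C) m₁ m₂ K S e ∧ S 1 = W ∧ e 1 = n₁) ∧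
        -- for a suitable `S_1`, any `n_1` beyond all synchronizing exponents will do
        ((initSpecial σ ξ C).Nonempty → ∃ W ∈ initSpecial σ ξ C, ∀ n₁ : ℕ,
          (∀ W₁ ∈ initSpecial σ ξ C, ∀ W₂ ∈ initSpecial σ ξ C, m₁ W₁ W₂ < n₁ ∧ m₂ W₁ W₂ < n₁) →
          ∃ (K : ℕ) (S : ℕ → Word) (e : ℕ → ℕ),
            IsUnison σ (initSpecial σ ξ C) m₁ m₂ K S e ∧ S 1 = W ∧ e 1 = n₁) ∧
        ∀ (K : ℕ) (S : ℕ → Word) (e : ℕ → ℕ),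
          IsUnison σ (initSpecial σ ξ C) m₁ m₂ K S e →
          -- `n_k` is the only exponent that puts `|T^{n_k}(S_k)|` into `I^0`
          (∀ k ∈ Set.Icc 1 K, ∀ n : ℕ,
            ((opT σ)^[n] (S k)).length ∈ block (pointN σ S e) 0 → n = e k) ∧
          -- the points keep their order
          (∀ j : ℕ, (∀ k ∈ Set.Ico 1 K, pointN σ S e k j ≤ pointN σ S e (k + 1) j) ∧
            pointN σ S e K j < pointN σ S e 1 (j + 1)) ∧
          -- the intervals `I^j` partition `[N_1^0, ∞)`, and the `I_k^j` partition `I^j`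
          (∀ n : ℕ, pointN σ S e 1 0 ≤ n → ∃! j : ℕ, n ∈ block (pointN σ S e) j) ∧
          (∀ j : ℕ, ∀ n ∈ block (pointN σ S e) j,
            ∃! k : ℕ, k ∈ Set.Icc 1 K ∧ n ∈ subblock K (pointN σ S e) k j) ∧
          -- the recurrence formula for `s(n + 1)`
          (∀ j : ℕ, ∀ n ∈ block (pointN σ S e) j,
            (specialCount ξ (n + 1) : ℤ) = specialCount ξ (pointN σ S e 1 j) +
              stepSum K (pointN σ S e) (totalJump σ ξ C K S e) j n) ∧
          -- the jumps: `c_k` at `N_k^j`, and none elsewhere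
          (∀ j : ℕ, ∀ k ∈ Set.Icc 1 K,
            (specialCount ξ (pointN σ S e k j + 1) : ℤ) - specialCount ξ (pointN σ S e k j) =
              jump σ ξ C K S e k) ∧
          (∀ n : ℕ, pointN σ S e 1 0 ≤ n → (∀ j : ℕ, ∀ k ∈ Set.Icc 1 K, n ≠ pointN σ S e k j) →
            specialCount ξ (n + 1) = specialCount ξ n) ∧
          -- the points satisfy the recurrence given by the characteristic polynomial
          (∀ k ∈ Set.Icc 1 K, LengthRecurrence σ (pointN σ S e k)) ∧
          -- the complexity is determined by the initial values
          (∀ (N : ℕ → ℕ → ℕ) (P : ℕ → ℤ),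
            (∀ k ∈ Set.Icc 1 K, N k 0 = pointN σ S e k 0 ∧ N k 1 = pointN σ S e k 1 ∧
              LengthRecurrence σ (N k)) →
            (∀ n : ℕ, n ≤ pointN σ S e 1 0 + 1 → P n = complexity ξ n) →
            (∀ j : ℕ, ∀ n ∈ block N j,
              P (n + 2) - P (n + 1) = P (N 1 j + 1) - P (N 1 j) +
                stepSum K N (totalJump σ ξ C K S e) j n) →
            ∀ n : ℕ, P n = complexity ξ n) := by
  have hmem : ∀ c d, d ∈ σ c := mem_image_of_isPrimitive hσ hprim
  refine ⟨fun n => by rw [complexity_succ]; push_cast; ring,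
    exists_isRecogConst hσ hmem hξ hper, fun C hC => ?_⟩
  have hmono : ∀ w ∈ initSpecial σ ξ C, StrictMono (orbitLength σ w) := fun w hw =>
    strictMono_orbitLength hmem (ne_nil_of_mem_initSpecial hw)
  have hfin := finite_initSpecial σ ξ C
  refine ⟨fun hE n hn => specialCount_succ_of_initSpecial_eq_empty hσ hmem hξ hC hE hn,
    exists_isSyncChoice hmem heig fun w hw => ne_nil_of_mem_initSpecial hw,
    fun m₁ m₂ hsync => ⟨fun W hW => exists_isUnison_of_large hfin hmono hsync hW,
      exists_isUnison_of_nonempty hfin hmono hsync, fun K S e h => ?_⟩⟩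
  refine ⟨fun k hk n hn => ?_, fun j => ⟨fun k hk => ?_, ?_⟩,
    fun n hn => h.existsUnique_block hmono hn,
    fun j n hn => h.existsUnique_subblock hsync hmono hn,
    fun j n hn => h.specialCount_succ_eq hsync hσ hmem hξ hC hn,
    fun j k hk => h.specialCount_jump hsync hσ hmem hξ hC j hk,
    fun n hn hne => h.specialCount_no_jump hsync hσ hmem hξ hC hn hne,
    fun k _ => lengthRecurrence_pointN σ S e k,
    fun N P hN hinit hP => h.complexity_determined hsync hσ hmem hξ hC hN hinit hP⟩
  · simpa using h.exponent_eq hsync hmono hk hn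
  · exact h.pointN_mono hsync hmono hk.1 (Nat.le_succ k) hk.2 j
  · exact (h.pointN_mem_block hsync hmono ⟨h.pos, le_rfl⟩ j).2
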